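/- **Setting.** Let $W:\{0,1\}\to\mathcal Y$ be a binary memoryless symmetric channel with finite output alphabet $\mathcal Y$, i.e. there is an involution $\pi$ of $\mathcal Y$ with $W(y\mid 1)=W(\pi(y)\mid 0)$ for all $y$. Let $I(W)$ be its capacity in bits, the maximum of the mutual information over all input distributions. For $m\ge 0$ put $n=2^m$ and $[m]=\{1,\dots,m\}$, and for $A\subseteq[m]$ let $v_m(A)\in\mathbb F_2^{\{0,1\}^m}$ be the vector with components $v_m(A,z)=\prod_{i\in A}z_i$. For $0\le r\le m$ the Reed–Muller code is $$\mathcal R(m,r)=\Big\{\sum_{|A|\le r}u(A)v_m(A):u(A)\in\{0,1\}\Big\}.$$ Order the subsets of $[m]$ totally: $A<B$ if $|A|>|B|$, or if $|A|=|B|$ and, writing both sets in decreasing order $a_1>a_2>\cdots$ and $b_1>b_2>\cdots$, there is $i$ with $a_j=b_j$ for all $j<i$ and $a_i<b_i$. Let $(U_A^{(m)})_{A\subseteq[m]}$ be i.i.d. Bernoulli-$1/2$, let $X^{(m)}=\sum_A U_A^{(m)}v_m(A)$ (mod 2), and let $Y^{(m)}\in\mathcal Y^{\{0,1\}^m}$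 be the output when the $n$ components of $X^{(m)}$ are sent through $n$ independent copies of $W$. Define, with entropies in bits, $$H_A^{(m)}=H\big(U_A^{(m)}\,\big|\,Y^{(m)},(U_B^{(m)})_{B<A}\big).$$ Let $$\theta_{\max}^{(m)}=\max\{0\le i\le m: H^{(m)}_{\{1,\dots,i\}}\le 1/2\},\qquad \theta_{\min}^{(m)}=\max\{0\le i\le m: H^{(m)}_{\{m-i+1,\dots,m\}}\le 1/2\},$$ where for $i=0$ the index set is $\emptyset$. Assume that for all sufficiently large $m$ these two maxima are over nonempty sets, so that $\theta_{\max}^{(m)}$ and $\theta_{\min}^{(m)}$ are defined. **Theorem.** If $\theta_{\min}^{(m)}-\theta_{\max}^{(m)}=o(\sqrt m)$ as $m\to\infty$, then Reed–Muller codes achieve the capacity of $W$: there are orders $0\le r(m)\le m$ and decoders $d_m:\mathcal Y^{\{0,1\}^m}\to\{0,1\}^{\{0,1\}^m}$ such that, as $m\to\infty$, the rate $\frac1n\log_2|\mathcal R(m,r(m))|$ tends to $I(W)$, and the block error probability of $d_m$ for a uniformly random codeword of $\mathcal R(m,r(m))$ sent through $n$ independent copies of $W$ tends to $0$. -/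

import Mathlib

open Filter Asymptotics

noncomputable section

namespace RMCapacity

/-! ### Binary-input channels -/

/-- A binary-input channel with finite output alphabet `𝒴`, given by its transition
probabilities `prob x y = W(y | x)`; the input alphabet `{0, 1}` is `ZMod 2`. -/
structure BinaryChannel (𝒴 : Type*) [Fintype 𝒴] where
  prob : ZMod 2 → 𝒴 → ℝ
  prob_nonneg : ∀ x y, 0 ≤ prob x y
  sum_prob : ∀ x, ∑ y, prob x y = 1

variable {𝒴 : Type*} [Fintype 𝒴]

/-- Symmetry: some involutive permutation `π` of the outputs satisfies `W(y | 1) = W(π y | 0)`.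
Memorylessness is built into the product law used for blocks of channel uses below. -/
def BinaryChannel.IsSymmetric (W : BinaryChannel 𝒴) : Prop :=
  ∃ π : Equiv.Perm 𝒴, Function.Involutive π ∧ ∀ y, W.prob 1 y = W.prob 0 (π y)

/-- Mutual information (in bits) between input and output for the input distribution `q`. -/
def BinaryChannel.mutualInfo (W : BinaryChannel 𝒴) (q : ZMod 2 → ℝ) : ℝ :=
  ∑ x, ∑ y, q x * W.prob x y * Real.logb 2 (W.prob x y / ∑ x', q x' * W.prob x' y)

/-- Channel capacity: the supremum of the mutual information over all input distributions. -/
def BinaryChannel.capacity (W : BinaryChannel 𝒴) : ℝ :=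
  sSup (W.mutualInfo '' stdSimplex ℝ (ZMod 2))

/-! ### Finite probability -/

/-- The probability of the event `E` under the mass function `p`. -/
def probOf {Ω : Type*} [Fintype Ω] (p : Ω → ℝ) (E : Ω → Prop) : ℝ :=
  open Classical in ∑ ω, if E ω then p ω else 0

/-- Conditional entropy `H(X | V) = 𝔼[-log₂ P(X | V)]` in bits. -/
def condEntropy {Ω S T : Type*} [Fintype Ω] (p : Ω → ℝ) (X : Ω → S) (V : Ω → T) : ℝ :=
  -∑ ω, p ω * Real.logb 2
    (probOf p (fun ω' => X ω' = X ω ∧ V ω' = V ω) / probOf p (fun ω' => V ω' = V ω))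

/-! ### Reed-Muller codes -/

/-- The points `z ∈ {0, 1}^m`; coordinate `i : Fin m` plays the role of `i + 1 ∈ [m]`. -/
abbrev Cube (m : ℕ) : Type := Fin m → ZMod 2

/-- Binary words of length `n = 2 ^ m`, indexed by the cube. -/
abbrev Word (m : ℕ) : Type := Cube m → ZMod 2

/-- `v_m(A)`: the evaluation vector of the monomial `∏_{i ∈ A} z_i`. -/
def monomialVec (m : ℕ) (A : Finset (Fin m)) : Word m := fun z => ∏ i ∈ A, z i

/-- The Reed-Muller code of order `r` and length `2 ^ m`. -/
def rmCode (m r : ℕ) : Finset (Word m) :=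
  Finset.univ.image fun u : Finset (Fin m) → ZMod 2 =>
    ∑ A with A.card ≤ r, u A • monomialVec m A

/-- The total order on subsets of `[m]`: larger sets come first; sets of equal size are compared
by the decreasing enumerations of their elements, lexicographically, which is the colexicographic
order. -/
def setLT {m : ℕ} (A B : Finset (Fin m)) : Prop :=
  B.card < A.card ∨ (A.card = B.card ∧ toColex A < toColex B)

/-! ### The conditional entropies `H_A` -/

/-- Sample space for `(U, Y)`: the bits `U_A`, `A ⊆ [m]`, and the outputs `Y_z`, `z ∈ {0,1}^m`. -/
abbrev Sample (𝒴 : Type*) (m : ℕ) : Type _ := (Finset (Fin m) → ZMod 2) × (Cube m → 𝒴)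

/-- `X = ∑_A U_A v_m(A)`. -/
def encode (m : ℕ) (u : Finset (Fin m) → ZMod 2) : Word m := ∑ A, u A • monomialVec m A

/-- Probability of receiving `y` when the word `x` is sent through independent uses of `W`. -/
def BinaryChannel.blockProb (W : BinaryChannel 𝒴) {m : ℕ} (x : Word m) (y : Cube m → 𝒴) : ℝ :=
  ∏ z, W.prob (x z) (y z)

/-- Joint law of `(U, Y)`: `U` is uniform on `{0,1}^(2^m)` and `Y` is the channel output for the
input `encode m U`. -/
def jointLaw (W : BinaryChannel 𝒴) (m : ℕ) (ω : Sample 𝒴 m) : ℝ :=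
  (1 / 2) ^ (2 ^ m) * W.blockProb (encode m ω.1) ω.2

/-- `H_A^{(m)} = H(U_A | Y, U_{<A})`. -/
def entropyAt (W : BinaryChannel 𝒴) (m : ℕ) (A : Finset (Fin m)) : ℝ :=
  condEntropy (jointLaw W m) (fun ω => ω.1 A)
    (fun ω => (ω.2, fun B : {B : Finset (Fin m) // setLT B A} => ω.1 B))

/-- The set `{1, …, i} ⊆ [m]`. -/
def firstSet (m i : ℕ) : Finset (Fin m) := Finset.univ.filter fun j => j.val < i

/-- The set `{m - i + 1, …, m} ⊆ [m]`. -/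
def lastSet (m i : ℕ) : Finset (Fin m) := Finset.univ.filter fun j => m ≤ j.val + i

/-- The indices `i ∈ {0, …, m}` with `H_{{1,…,i}} ≤ 1/2`. -/
def lowMax (W : BinaryChannel 𝒴) (m : ℕ) : Set ℕ :=
  {i | i ≤ m ∧ entropyAt W m (firstSet m i) ≤ 1 / 2}

/-- The indices `i ∈ {0, …, m}` with `H_{{m-i+1,…,m}} ≤ 1/2`. -/
def lowMin (W : BinaryChannel 𝒴) (m : ℕ) : Set ℕ :=
  {i | i ≤ m ∧ entropyAt W m (lastSet m i) ≤ 1 / 2}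

/-- `θ_max^{(m)}`: the largest element of `lowMax W m` when that set is nonempty. -/
def thetaMax (W : BinaryChannel 𝒴) (m : ℕ) : ℕ := sSup (lowMax W m)

/-- `θ_min^{(m)}`: the largest element of `lowMin W m` when that set is nonempty. -/
def thetaMin (W : BinaryChannel 𝒴) (m : ℕ) : ℕ := sSup (lowMin W m)

/-! ### Achieving capacity -/

/-- The rate `log₂ |C| / n` of a code of length `n = 2 ^ m`. -/
def rate {m : ℕ} (C : Finset (Word m)) : ℝ := Real.logb 2 (C.card : ℝ) / 2 ^ m

/-- Block error probability of the decoder `d` for a uniformly random codeword of `C` sent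
through `2 ^ m` independent uses of `W`. -/
def blockError (W : BinaryChannel 𝒴) {m : ℕ} (C : Finset (Word m))
    (d : (Cube m → 𝒴) → Word m) : ℝ :=
  (C.card : ℝ)⁻¹ * ∑ x ∈ C, ∑ y, if d y = x then 0 else W.blockProb x y

/-- Reed-Muller codes achieve the capacity of `W`: for suitable orders `0 ≤ r(m) ≤ m` and
decoders, the rates tend to the capacity and the block error probabilities tend to zero. -/
def ReedMullerAchievesCapacity (W : BinaryChannel 𝒴) : Prop :=
  ∃ (r : ℕ → ℕ) (d : (m : ℕ) → (Cube m → 𝒴) → Word m),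
    (∀ m, r m ≤ m) ∧
    Tendsto (fun m => rate (rmCode m (r m))) atTop (nhds W.capacity) ∧
    Tendsto (fun m => blockError W (rmCode m (r m)) (d m)) atTop (nhds 0)

end RMCapacity

end

noncomputable section

namespace RMCapacity

/-! ### Finite probability -/

section Functional

variable {Ω Ω' T T' : Type*} [Fintype Ω] [Fintype Ω'] [Fintype T] [Fintype T']

/-! The uncertainty of a bit is measured by entropy H, Bhattacharyya parameter Z and quadratic
uncertainty Q. All three are symmetric, homogeneous and superadditive (`IsUncertainty`), so extra
observations can only lower them.

Fixing one coordinate of the cube splits a sample of length 2^(m+1) into two independent samples of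
length 2^m. Because larger sets are revealed first, the bit of a set avoiding the coordinate is at
least as well observed as in the polar "plus" transform (`uncAt_liftSet_le_plus`), and the bit of a
set containing it at most as well as in the "minus" transform (`minus_le_uncAt_insert`). So
uncertainty increases with inclusion, and 1 - Q is bounded by its square along strict inclusions
(`one_sub_uncAt_quadUnc_le_sq`). Unpolarized sets with nearly equal Q therefore form an antichain,
and Sperner's theorem leaves only O(2^m / √m) unpolarized sets (`card_unpolarized_le`).

Permuting coordinates shows that on each level the initial segment has the most uncertain bit and
the final segment the least. So H ≤ 1/2 up to level θ_max and H > 1/2 above level θ_min; the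
hypothesis makes the levels in between negligible, since each has at most 2^m / √m sets. Up to
o(2^m) sets, H is thus near 0 for sizes at most θ_max and near 1 for larger ones. By the chain rule
the entropies sum to 2^m (1 - I) (`sum_uncAt_entropyUnc`), so the code of order θ_max has rate
tending to I, which is the capacity by symmetry.

For reliability the order used at length 2^m is θ_max at m - k, with k = log₂ m + O(1). Adding k
coordinates squares Z k times, which beats the 2^m terms of the union bound, while θ_max moves by at
most k = o(√m), so the rate survives. The error of a maximum a posteriori decoder that knows the
frozen bits is at most log 2 times the sum of the entropies of the other bits; averaging over cosets
and channel symmetry transfer this bound to the code itself (`exists_decoder_blockError_le`). -/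

theorem probOf_eq_sum_filter (p : Ω → ℝ) (E : Ω → Prop) [DecidablePred E] :
    probOf p E = ∑ ω with E ω, p ω := by
  classical
  rw [Finset.sum_filter, probOf]
  exact Finset.sum_congr rfl fun ω _ => by congr

theorem probOf_nonneg {p : Ω → ℝ} (hp : ∀ ω, 0 ≤ p ω) (E : Ω → Prop) : 0 ≤ probOf p E := by
  classical
  rw [probOf_eq_sum_filter]
  exact Finset.sum_nonneg fun ω _ => hp ω

theorem probOf_congr (p : Ω → ℝ) {E E' : Ω → Prop} (h : ∀ ω, E ω ↔ E' ω) :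
    probOf p E = probOf p E' := by
  congr 1
  exact funext fun ω => propext (h ω)

theorem le_probOf {p : Ω → ℝ} (hp : ∀ ω, 0 ≤ p ω) {E : Ω → Prop} {ω : Ω} (h : E ω) :
    p ω ≤ probOf p E := by
  classical
  rw [probOf_eq_sum_filter]
  exact Finset.single_le_sum (f := p) (fun ω _ => hp ω) (by simpa using h)

theorem probOf_true (p : Ω → ℝ) : probOf p (fun _ => True) = ∑ ω, p ω := by
  simp [probOf]

theorem probOf_comp_equiv (e : Ω ≃ Ω') (p : Ω' → ℝ) (E : Ω' → Prop) :
    probOf (fun ω => p (e ω)) (fun ω => E (e ω)) = probOf p E := by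
  classical
  exact e.sum_comp fun ω => if E ω then p ω else 0

theorem sum_probOf_fiber (p : Ω → ℝ) (E : Ω → Prop) (V : Ω → T) :
    ∑ t, probOf p (fun ω => E ω ∧ V ω = t) = probOf p E := by
  classical
  unfold probOf
  rw [Finset.sum_comm]
  refine Finset.sum_congr rfl fun ω _ => ?_
  by_cases h : E ω <;> simp [h]

theorem sum_probOf_eq (p : Ω → ℝ) (V : Ω → T) :
    ∑ t, probOf p (fun ω => V ω = t) = ∑ ω, p ω := by
  rw [← probOf_true p, ← sum_probOf_fiber p _ V]
  simp

theorem probOf_prod (p : Ω → ℝ) (q : Ω' → ℝ) (E : Ω → Prop) (E' : Ω' → Prop) :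
    probOf (fun ω : Ω × Ω' => p ω.1 * q ω.2) (fun ω => E ω.1 ∧ E' ω.2) =
      probOf p E * probOf q E' := by
  classical
  unfold probOf
  rw [Fintype.sum_prod_type, Finset.sum_mul_sum]
  refine Finset.sum_congr rfl fun a _ => Finset.sum_congr rfl fun b _ => ?_
  by_cases h : E a <;> by_cases h' : E' b <;> simp [h, h']

theorem probOf_or_bit (p : Ω → ℝ) (X : Ω → ZMod 2) (E : Ω → Prop) :
    probOf p E = probOf p (fun ω => X ω = 0 ∧ E ω) + probOf p (fun ω => X ω = 1 ∧ E ω) := by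
  rw [← sum_probOf_fiber p E X]
  refine (Fin.sum_univ_two (fun t : Fin 2 => probOf p (fun ω => E ω ∧ X ω = t))).trans ?_
  congr 1 <;> exact probOf_congr p fun ω => and_comm

/-! ### Conditional uncertainty functionals -/

/-- Measures `f a b` of the uncertainty of a bit with unnormalised probabilities `a` and `b`. -/
structure IsUncertainty (f : ℝ → ℝ → ℝ) : Prop where
  symm : ∀ a b, f a b = f b a
  smul : ∀ t a b, 0 ≤ t → 0 ≤ a → 0 ≤ b → f (t * a) (t * b) = t * f a b
  superadd : ∀ a b c d, 0 ≤ a → 0 ≤ b → 0 ≤ c → 0 ≤ d → f a b + f c d ≤ f (a + c) (b + d)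

theorem IsUncertainty.zero {f : ℝ → ℝ → ℝ} (hf : IsUncertainty f) : f 0 0 = 0 := by
  simpa using hf.smul 0 0 0 le_rfl le_rfl le_rfl

/-- Jensen's inequality in homogeneous form; it is what makes merging observations increase the
uncertainty. -/
theorem IsUncertainty.sum_le {f : ℝ → ℝ → ℝ} (hf : IsUncertainty f) {ι : Type*} (s : Finset ι)
    (a b : ι → ℝ) (ha : ∀ i, 0 ≤ a i) (hb : ∀ i, 0 ≤ b i) :
    ∑ i ∈ s, f (a i) (b i) ≤ f (∑ i ∈ s, a i) (∑ i ∈ s, b i) := by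
  classical
  induction s using Finset.induction_on with
  | empty => simp [hf.zero]
  | insert i s hi ih =>
    rw [Finset.sum_insert hi, Finset.sum_insert hi, Finset.sum_insert hi]
    refine (add_le_add le_rfl ih).trans ?_
    exact hf.superadd _ _ _ _ (ha i) (hb i) (Finset.sum_nonneg fun j _ => ha j)
      (Finset.sum_nonneg fun j _ => hb j)

/-- Average uncertainty of the bit `X` given the observation `V`, as measured by `f`. -/
def condUnc (f : ℝ → ℝ → ℝ) (p : Ω → ℝ) (X : Ω → ZMod 2) (V : Ω → T) : ℝ :=
  ∑ v, f (probOf p fun ω => X ω = 0 ∧ V ω = v) (probOf p fun ω => X ω = 1 ∧ V ω = v)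

theorem condUnc_comp_equiv (f : ℝ → ℝ → ℝ) (e : Ω ≃ Ω') (p : Ω' → ℝ) (X : Ω' → ZMod 2)
    (V : Ω' → T) :
    condUnc f (fun ω => p (e ω)) (fun ω => X (e ω)) (fun ω => V (e ω)) = condUnc f p X V := by
  refine Finset.sum_congr rfl fun v _ => ?_
  rw [probOf_comp_equiv e p fun ω => X ω = 0 ∧ V ω = v,
    probOf_comp_equiv e p fun ω => X ω = 1 ∧ V ω = v]

theorem condUnc_comp_le {f : ℝ → ℝ → ℝ} (hf : IsUncertainty f) {p : Ω → ℝ} (hp : ∀ ω, 0 ≤ p ω)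
    (X : Ω → ZMod 2) (V : Ω → T) (φ : T → T') :
    condUnc f p X V ≤ condUnc f p X (fun ω => φ (V ω)) := by
  classical
  unfold condUnc
  rw [← Finset.sum_fiberwise Finset.univ φ]
  refine Finset.sum_le_sum fun t _ => ?_
  have key : ∀ x : ZMod 2, probOf p (fun ω => X ω = x ∧ φ (V ω) = t) =
      ∑ v with φ v = t, probOf p (fun ω => X ω = x ∧ V ω = v) := by
    intro x
    rw [← sum_probOf_fiber p _ V, Finset.sum_filter]
    refine Finset.sum_congr rfl fun v _ => ?_
    split_ifs with h
    · exact probOf_congr p fun ω => by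
        constructor
        · rintro ⟨⟨h1, -⟩, h2⟩; exact ⟨h1, h2⟩
        · rintro ⟨h1, h2⟩; exact ⟨⟨h1, by rw [h2, h]⟩, h2⟩
    · rw [probOf_eq_sum_filter, Finset.sum_eq_zero]
      simp only [Finset.mem_filter, Finset.mem_univ, true_and]
      rintro ω ⟨⟨-, h1⟩, h2⟩
      exact absurd (h2 ▸ h1) h
  rw [key 0, key 1]
  exact hf.sum_le _ _ _ (fun v => probOf_nonneg hp _) fun v => probOf_nonneg hp _

/-- Observing more decreases the uncertainty. -/
theorem condUnc_le_of_finer {f : ℝ → ℝ → ℝ} (hf : IsUncertainty f) {p : Ω → ℝ}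
    (hp : ∀ ω, 0 ≤ p ω) (X : Ω → ZMod 2) (V : Ω → T) (V' : Ω → T')
    (h : ∀ ω ω', V ω = V ω' → V' ω = V' ω') : condUnc f p X V ≤ condUnc f p X V' := by
  rcases isEmpty_or_nonempty Ω with hΩ | ⟨⟨ω₀⟩⟩
  · simp [condUnc, probOf, hf.zero]
  · have : Nonempty T' := ⟨V' ω₀⟩
    obtain ⟨φ, hφ⟩ := (Function.factorsThrough_iff (f := V) V').1 fun ω ω' => h ω ω'
    rw [hφ]
    exact condUnc_comp_le hf hp X V φ

/-- Within a cell of `V` the added bit is constant, so it either does nothing or swaps the two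
arguments of the symmetric `f`. -/
theorem condUnc_add_of_observed {f : ℝ → ℝ → ℝ} (hf : IsUncertainty f) (p : Ω → ℝ)
    (X : Ω → ZMod 2) (V : Ω → T) (g : T → ZMod 2) :
    condUnc f p (fun ω => X ω + g (V ω)) V = condUnc f p X V := by
  refine Finset.sum_congr rfl fun v _ => ?_
  have key : ∀ x, probOf p (fun ω => X ω + g (V ω) = x ∧ V ω = v) =
      probOf p (fun ω => X ω = x + g v ∧ V ω = v) := by
    intro x
    refine probOf_congr p fun ω => and_congr_left fun h => ?_
    rw [h]
    generalize X ω = a; generalize g v = b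
    revert a b x; decide
  rw [key, key]
  generalize g v = b
  have hb : b = 0 ∨ b = 1 := by revert b; decide
  rcases hb with rfl | rfl
  · simp
  · rw [hf.symm]
    have h2 : (1 : ZMod 2) + 1 = 0 := by decide
    simp [h2]

/-- Independent side information is worthless: homogeneity pulls out the factor P(V' = v'), and
these factors sum to one. -/
theorem condUnc_prod_left {f : ℝ → ℝ → ℝ} (hf : IsUncertainty f) {p : Ω → ℝ} {q : Ω' → ℝ}
    (hp : ∀ ω, 0 ≤ p ω) (hq : ∀ ω, 0 ≤ q ω) (hq1 : ∑ ω, q ω = 1)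
    (X : Ω → ZMod 2) (V : Ω → T) (V' : Ω' → T') :
    condUnc f (fun ω : Ω × Ω' => p ω.1 * q ω.2) (fun ω => X ω.1) (fun ω => (V ω.1, V' ω.2)) =
      condUnc f p X V := by
  have key : ∀ x v v', probOf (fun ω : Ω × Ω' => p ω.1 * q ω.2)
      (fun ω => X ω.1 = x ∧ (V ω.1, V' ω.2) = (v, v')) =
      probOf q (fun ω => V' ω = v') * probOf p (fun ω => X ω = x ∧ V ω = v) := by
    intro x v v'
    rw [mul_comm, ← probOf_prod]
    exact probOf_congr _ fun ω => by rw [Prod.mk.injEq, and_assoc]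
  unfold condUnc
  rw [Fintype.sum_prod_type]
  refine Finset.sum_congr rfl fun v _ => ?_
  simp only [key]
  rw [Finset.sum_congr rfl fun v' _ => hf.smul _ _ _ (probOf_nonneg hq _) (probOf_nonneg hp _)
    (probOf_nonneg hp _), ← Finset.sum_mul, sum_probOf_eq, hq1, one_mul]

/-- The polar "minus" transform increases the uncertainty. -/
theorem condUnc_le_minus {f : ℝ → ℝ → ℝ} (hf : IsUncertainty f) {p : Ω → ℝ}
    (hp : ∀ ω, 0 ≤ p ω) (hp1 : ∑ ω, p ω = 1) (X : Ω → ZMod 2) (V : Ω → T) :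
    condUnc f p X V ≤ condUnc f (fun ω : Ω × Ω => p ω.1 * p ω.2)
      (fun ω => X ω.1 + X ω.2) (fun ω => (V ω.1, V ω.2)) := by
  have hpp : ∀ ω : Ω × Ω, 0 ≤ p ω.1 * p ω.2 := fun ω => mul_nonneg (hp _) (hp _)
  -- Reveal the whole independent second sample. The first bit and the sum of the two bits are then
  -- equally uncertain, and forgetting all of the second sample but its `V` only hurts.
  rw [← condUnc_prod_left hf hp hp hp1 X V (id : Ω → Ω),
    ← condUnc_add_of_observed hf _ _ _ fun t : T × Ω => X t.2]
  exact condUnc_le_of_finer hf hpp _ _ _ fun ω ω' h => by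
    simp only [Prod.mk.injEq, id] at h ⊢
    exact ⟨h.1, by rw [h.2]⟩

/-- The polar "plus" transform decreases the uncertainty. -/
theorem plus_le_condUnc {f : ℝ → ℝ → ℝ} (hf : IsUncertainty f) {p : Ω → ℝ}
    (hp : ∀ ω, 0 ≤ p ω) (hp1 : ∑ ω, p ω = 1) (X : Ω → ZMod 2) (V : Ω → T) :
    condUnc f (fun ω : Ω × Ω => p ω.1 * p ω.2) (fun ω => X ω.1)
      (fun ω => ((V ω.1, V ω.2), X ω.1 + X ω.2)) ≤ condUnc f p X V := by
  have hpp : ∀ ω : Ω × Ω, 0 ≤ p ω.1 * p ω.2 := fun ω => mul_nonneg (hp _) (hp _)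
  rw [← condUnc_prod_left hf hp hp hp1 X V V]
  exact condUnc_le_of_finer hf hpp _ _ _ fun ω ω' h => (Prod.mk.inj h).1

end Functional

/-! ### Entropy, Bhattacharyya parameter and quadratic uncertainty -/

section Measures

variable {Ω T : Type*} [Fintype Ω] [Fintype T]

/-- Binary entropy in bits, homogenised. -/
def entropyUnc (a b : ℝ) : ℝ := -(a * Real.logb 2 (a / (a + b)) + b * Real.logb 2 (b / (a + b)))

/-- The Bhattacharyya measure of uncertainty. -/
def bhattaUnc (a b : ℝ) : ℝ := 2 * Real.sqrt (a * b)

/-- The quadratic measure of uncertainty. -/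
def quadUnc (a b : ℝ) : ℝ := 4 * a * b / (a + b)

theorem mul_log_sub_log_le {a b : ℝ} (ha : 0 ≤ a) (hb : 0 ≤ b) (h : b = 0 → a = 0) :
    a * (Real.log b - Real.log a) ≤ b - a := by
  rcases ha.eq_or_lt with rfl | ha
  · simpa using hb
  have hb : 0 < b := lt_of_le_of_ne hb fun h0 => ha.ne' (h h0.symm)
  rw [← Real.log_div hb.ne' ha.ne']
  calc a * Real.log (b / a) ≤ a * (b / a - 1) :=
        mul_le_mul_of_nonneg_left (Real.log_le_sub_one_of_pos (div_pos hb ha)) ha.le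
    _ = b - a := by field_simp

/-- The log-sum inequality, from the tangent bound log x ≤ x - 1 applied to each term at the common
ratio r = (a + c) / (s + t); the linear errors cancel because s r + t r = a + c. -/
theorem log_sum_le {a c s t : ℝ} (ha : 0 ≤ a) (hc : 0 ≤ c) (has : a ≤ s) (hct : c ≤ t) :
    (a + c) * Real.log ((a + c) / (s + t)) ≤ a * Real.log (a / s) + c * Real.log (c / t) := by
  rcases ha.eq_or_lt with rfl | ha'
  · rcases hc.eq_or_lt with rfl | hc'
    · simp
    · have ht : 0 < t := hc'.trans_le hct
      simp only [zero_add, zero_mul]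
      refine mul_le_mul_of_nonneg_left (Real.log_le_log (by positivity) ?_) hc
      exact div_le_div_of_nonneg_left hc ht (by linarith)
  have hs : 0 < s := ha'.trans_le has
  have hst : 0 < s + t := by linarith
  have hr : 0 < (a + c) / (s + t) := by positivity
  set r := (a + c) / (s + t) with hrdef
  have h1 : a * (Real.log r - Real.log (a / s)) ≤ s * r - a := by
    have := mul_log_sub_log_le ha (mul_pos hs hr).le fun h0 => absurd h0 (mul_pos hs hr).ne'
    rwa [Real.log_mul hs.ne' hr.ne', show Real.log s + Real.log r - Real.log a =
      Real.log r - (Real.log a - Real.log s) by ring, ← Real.log_div ha'.ne' hs.ne'] at this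
  have h2 : c * (Real.log r - Real.log (c / t)) ≤ t * r - c := by
    rcases hc.eq_or_lt with rfl | hc'
    · simpa using mul_nonneg hct hr.le
    have ht : 0 < t := hc'.trans_le hct
    have := mul_log_sub_log_le hc (mul_pos ht hr).le fun h0 => absurd h0 (mul_pos ht hr).ne'
    rwa [Real.log_mul ht.ne' hr.ne', show Real.log t + Real.log r - Real.log c =
      Real.log r - (Real.log c - Real.log t) by ring, ← Real.log_div hc'.ne' ht.ne'] at this
  have h3 : s * r + t * r = a + c := by
    rw [← add_mul, hrdef]; field_simp
  nlinarith

theorem isUncertainty_entropyUnc : IsUncertainty entropyUnc where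
  symm a b := by unfold entropyUnc; rw [add_comm b a]; ring
  smul t a b ht _ _ := by
    unfold entropyUnc
    rcases ht.eq_or_lt with rfl | ht
    · simp
    · rw [← mul_add, mul_div_mul_left _ _ ht.ne', mul_div_mul_left _ _ ht.ne']; ring
  superadd a b c d ha hb hc hd := by
    have h1 := log_sum_le ha hc (le_add_of_nonneg_right hb) (le_add_of_nonneg_right hd)
    have h2 := log_sum_le hb hd (le_add_of_nonneg_left ha) (le_add_of_nonneg_left hc)
    have h3 : a + c + (b + d) = a + b + (c + d) := by ring
    have hl : 0 < Real.log 2 := Real.log_pos one_lt_two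
    simp only [entropyUnc, Real.logb, h3]
    rw [← sub_nonneg]
    have : 0 ≤ (a * Real.log (a / (a + b)) + c * Real.log (c / (c + d)) -
        (a + c) * Real.log ((a + c) / (a + b + (c + d))) +
        (b * Real.log (b / (a + b)) + d * Real.log (d / (c + d)) -
        (b + d) * Real.log ((b + d) / (a + b + (c + d))))) / Real.log 2 :=
      div_nonneg (by linarith) hl.le
    refine this.trans_eq ?_
    ring

theorem isUncertainty_bhattaUnc : IsUncertainty bhattaUnc where
  symm a b := by unfold bhattaUnc; rw [mul_comm a b]
  smul t a b ht _ _ := by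
    unfold bhattaUnc
    rw [show t * a * (t * b) = t ^ 2 * (a * b) by ring, Real.sqrt_mul (sq_nonneg t),
      Real.sqrt_sq ht]
    ring
  superadd a b c d ha hb hc hd := by
    unfold bhattaUnc
    rw [← mul_add]
    refine mul_le_mul_of_nonneg_left ?_ zero_le_two
    refine Real.le_sqrt_of_sq_le ?_
    have h1 := Real.sq_sqrt (mul_nonneg ha hb)
    have h2 := Real.sq_sqrt (mul_nonneg hc hd)
    -- Regrouping the cross term reduces the claim to the AM-GM inequality for ad and bc.
    have h3 : Real.sqrt (a * b) * Real.sqrt (c * d) = Real.sqrt (a * d) * Real.sqrt (b * c) := by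
      rw [← Real.sqrt_mul (mul_nonneg ha hb), ← Real.sqrt_mul (mul_nonneg ha hd)]
      congr 1; ring
    have h4 := Real.sq_sqrt (mul_nonneg ha hd)
    have h5 := Real.sq_sqrt (mul_nonneg hb hc)
    nlinarith [sq_nonneg (Real.sqrt (a * d) - Real.sqrt (b * c))]

theorem quadUnc_eq {a b : ℝ} (ha : 0 ≤ a) (hb : 0 ≤ b) :
    quadUnc a b = a + b - (a - b) ^ 2 / (a + b) := by
  unfold quadUnc
  rcases (add_nonneg ha hb).eq_or_lt with h | h
  · simp [← h]
  · field_simp; ring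

theorem isUncertainty_quadUnc : IsUncertainty quadUnc where
  symm a b := by unfold quadUnc; rw [add_comm b a]; ring
  smul t a b ht _ _ := by
    unfold quadUnc
    rcases ht.eq_or_lt with rfl | ht
    · simp
    · rw [← mul_add, show 4 * (t * a) * (t * b) = t * (t * (4 * a * b)) by ring,
        mul_div_mul_left _ _ ht.ne', mul_div_assoc]
  superadd a b c d ha hb hc hd := by
    unfold quadUnc
    rcases (add_nonneg ha hb).eq_or_lt with h | h
    · obtain rfl : a = 0 := by linarith
      obtain rfl : b = 0 := by linarith
      simp
    rcases (add_nonneg hc hd).eq_or_lt with h' | h'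
    · obtain rfl : c = 0 := by linarith
      obtain rfl : d = 0 := by linarith
      simp
    have h3 : 0 < a + c + (b + d) := by linarith
    rw [div_add_div _ _ h.ne' h'.ne', div_le_div_iff₀ (mul_pos h h') h3]
    nlinarith [sq_nonneg (a * d - b * c)]

theorem sum_mul_comp_eq (p : Ω → ℝ) (K : Ω → T) (g : T → ℝ) :
    ∑ ω, p ω * g (K ω) = ∑ k, probOf p (fun ω => K ω = k) * g k := by
  classical
  simp only [probOf_eq_sum_filter, Finset.sum_mul]
  rw [← Finset.sum_fiberwise Finset.univ K]
  refine Finset.sum_congr rfl fun k _ => Finset.sum_congr rfl fun ω hω => ?_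
  rw [(Finset.mem_filter.1 hω).2]

theorem sum_zmod_two {M : Type*} [AddCommMonoid M] (g : ZMod 2 → M) : ∑ x, g x = g 0 + g 1 :=
  Fin.sum_univ_two g

theorem prod_zmod_two {M : Type*} [CommMonoid M] (g : ZMod 2 → M) : ∏ x, g x = g 0 * g 1 :=
  Fin.prod_univ_two g

theorem condEntropy_eq_condUnc (p : Ω → ℝ) (X : Ω → ZMod 2) (V : Ω → T) :
    condEntropy p X V = condUnc entropyUnc p X V := by
  have h := sum_mul_comp_eq p (fun ω => (V ω, X ω)) fun k =>
    Real.logb 2 (probOf p (fun ω' => X ω' = k.2 ∧ V ω' = k.1) / probOf p (fun ω' => V ω' = k.1))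
  unfold condEntropy condUnc
  rw [h, Fintype.sum_prod_type, ← Finset.sum_neg_distrib]
  refine Finset.sum_congr rfl fun v _ => ?_
  rw [sum_zmod_two, entropyUnc, probOf_or_bit p X fun ω => V ω = v]
  have hc : ∀ x, probOf p (fun ω => (V ω, X ω) = (v, x)) =
      probOf p (fun ω => X ω = x ∧ V ω = v) := fun x =>
    probOf_congr p fun ω => by rw [Prod.mk.injEq, and_comm]
  rw [hc, hc]

theorem condEntropy_congr {S S' T' T'' : Type*} (p : Ω → ℝ) {X : Ω → S} {X' : Ω → S'} {V : Ω → T'}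
    {V' : Ω → T''} (hX : ∀ ω ω', X ω = X ω' ↔ X' ω = X' ω')
    (hV : ∀ ω ω', V ω = V ω' ↔ V' ω = V' ω') :
    condEntropy p X V = condEntropy p X' V' := by
  unfold condEntropy
  simp only [hX, hV]

theorem sum_probOf_bit {p : Ω → ℝ} (hp1 : ∑ ω, p ω = 1) (X : Ω → ZMod 2) (V : Ω → T) :
    ∑ v, (probOf p (fun ω => X ω = 0 ∧ V ω = v) + probOf p (fun ω => X ω = 1 ∧ V ω = v)) = 1 := by
  rw [← hp1, ← sum_probOf_eq p V]
  exact Finset.sum_congr rfl fun v _ => (probOf_or_bit p X _).symm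

theorem one_sub_condUnc_quadUnc {p : Ω → ℝ} (hp : ∀ ω, 0 ≤ p ω) (hp1 : ∑ ω, p ω = 1)
    (X : Ω → ZMod 2) (V : Ω → T) :
    1 - condUnc quadUnc p X V =
      ∑ v, (probOf p (fun ω => X ω = 0 ∧ V ω = v) - probOf p (fun ω => X ω = 1 ∧ V ω = v)) ^ 2 /
        (probOf p (fun ω => X ω = 0 ∧ V ω = v) + probOf p (fun ω => X ω = 1 ∧ V ω = v)) := by
  unfold condUnc
  rw [Finset.sum_congr rfl fun v _ => quadUnc_eq (probOf_nonneg hp _) (probOf_nonneg hp _),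
    Finset.sum_sub_distrib, sum_probOf_bit hp1]
  ring

/-! ### Exact polar recursions for Q and Z -/

/-- With cell masses a, b and c, d in the two samples, the sum of the bits has masses ac + bd and ad
+ bc. Their difference (a - b)(c - d) and their total (a + b)(c + d) both factor, so 1 - Q is
multiplicative. -/
theorem condUnc_quadUnc_minus {p : Ω → ℝ} (hp : ∀ ω, 0 ≤ p ω) (hp1 : ∑ ω, p ω = 1)
    (X : Ω → ZMod 2) (V : Ω → T) :
    1 - condUnc quadUnc (fun ω : Ω × Ω => p ω.1 * p ω.2)
      (fun ω => X ω.1 + X ω.2) (fun ω => (V ω.1, V ω.2)) = (1 - condUnc quadUnc p X V) ^ 2 := by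
  have hpp : ∀ ω : Ω × Ω, 0 ≤ p ω.1 * p ω.2 := fun ω => mul_nonneg (hp _) (hp _)
  have hpp1 : ∑ ω : Ω × Ω, p ω.1 * p ω.2 = 1 := by
    rw [Fintype.sum_prod_type, ← Finset.sum_mul_sum, hp1, one_mul]
  rw [one_sub_condUnc_quadUnc hpp hpp1, one_sub_condUnc_quadUnc hp hp1, sq, Finset.sum_mul_sum,
    Fintype.sum_prod_type]
  refine Finset.sum_congr rfl fun v _ => Finset.sum_congr rfl fun v' _ => ?_
  have key : ∀ x, probOf (fun ω : Ω × Ω => p ω.1 * p ω.2)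
      (fun ω => X ω.1 + X ω.2 = x ∧ (V ω.1, V ω.2) = (v, v')) =
      probOf p (fun ω => X ω = 0 ∧ V ω = v) * probOf p (fun ω => X ω = x ∧ V ω = v') +
      probOf p (fun ω => X ω = 1 ∧ V ω = v) * probOf p (fun ω => X ω = x + 1 ∧ V ω = v') := by
    intro x
    rw [probOf_or_bit _ (fun ω : Ω × Ω => X ω.1), ← probOf_prod, ← probOf_prod]
    congr 1 <;> refine probOf_congr _ fun ω => ?_ <;> rw [Prod.mk.injEq] <;>
      generalize X ω.1 = a <;> generalize X ω.2 = b <;> generalize V ω.1 = c <;>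
      generalize V ω.2 = d
    · have : ∀ a b x : ZMod 2, a = 0 → (a + b = x ↔ b = x) := by decide
      have := this a b x; tauto
    · have : ∀ a b x : ZMod 2, a = 1 → (a + b = x ↔ b = x + 1) := by decide
      have := this a b x; tauto
  have h2 : (1 : ZMod 2) + 1 = 0 := by decide
  rw [key, key, h2, zero_add, div_mul_div_comm, ← mul_pow]
  congr 1 <;> ring

/-- For either value of the observed sum, the two masses of the first bit multiply to abcd, so the
square root factors; the two values of the sum supply the missing factor 2. -/
theorem condUnc_bhattaUnc_plus {p : Ω → ℝ} (hp : ∀ ω, 0 ≤ p ω) (X : Ω → ZMod 2) (V : Ω → T) :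
    condUnc bhattaUnc (fun ω : Ω × Ω => p ω.1 * p ω.2) (fun ω => X ω.1)
      (fun ω => ((V ω.1, V ω.2), X ω.1 + X ω.2)) = condUnc bhattaUnc p X V ^ 2 := by
  unfold condUnc
  rw [sq, Finset.sum_mul_sum, Fintype.sum_prod_type, Fintype.sum_prod_type]
  refine Finset.sum_congr rfl fun v _ => Finset.sum_congr rfl fun v' _ => ?_
  have key : ∀ x c, probOf (fun ω : Ω × Ω => p ω.1 * p ω.2)
      (fun ω => X ω.1 = x ∧ ((V ω.1, V ω.2), X ω.1 + X ω.2) = ((v, v'), c)) =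
      probOf p (fun ω => X ω = x ∧ V ω = v) * probOf p (fun ω => X ω = x + c ∧ V ω = v') := by
    intro x c
    rw [← probOf_prod]
    refine probOf_congr _ fun ω => ?_
    rw [Prod.mk.injEq, Prod.mk.injEq]
    generalize X ω.1 = a; generalize X ω.2 = b
    have : ∀ a b x c : ZMod 2, a = x → (a + b = c ↔ b = x + c) := by decide
    have := this a b x c
    tauto
  have h2 : (1 : ZMod 2) + 1 = 0 := by decide
  rw [sum_zmod_two]
  simp only [key, h2, zero_add, add_zero, bhattaUnc]
  have n : ∀ x v, 0 ≤ probOf p (fun ω => X ω = x ∧ V ω = v) := fun x v => probOf_nonneg hp _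
  have e0 := n 0 v; have e1 := n 1 v; have e2 := n 0 v'; have e3 := n 1 v'
  generalize probOf p (fun ω => X ω = 0 ∧ V ω = v) = a at *
  generalize probOf p (fun ω => X ω = 1 ∧ V ω = v) = b at *
  generalize probOf p (fun ω => X ω = 0 ∧ V ω = v') = c at *
  generalize probOf p (fun ω => X ω = 1 ∧ V ω = v') = d at *
  rw [show a * c * (b * d) = a * b * (c * d) by ring, show a * d * (b * c) = a * b * (c * d) by ring,
    Real.sqrt_mul (mul_nonneg e0 e1)]
  ring

/-! ### Inequalities between the three measures -/

theorem log_two_mul_entropyUnc_le {a b : ℝ} (ha : 0 ≤ a) (hb : 0 ≤ b) :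
    Real.log 2 * entropyUnc a b ≤ bhattaUnc a b := by
  have hl : Real.log 2 ≠ 0 := (Real.log_pos one_lt_two).ne'
  have h0 : Real.log 2 * entropyUnc a b =
      -(a * Real.log (a / (a + b)) + b * Real.log (b / (a + b))) := by
    unfold entropyUnc Real.logb
    field_simp
  rw [h0]
  -- This is -log u ≤ 2 (1/√u - 1) at u = x / s, that is, log w ≤ w - 1 at w = 1/√u.
  have key : ∀ x s : ℝ, 0 ≤ x → x ≤ s →
      -(x * Real.log (x / s)) ≤ 2 * (Real.sqrt x * Real.sqrt s - x) := by
    intro x s hx hxs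
    rcases hx.eq_or_lt with rfl | hx'
    · simp
    have hs : 0 < s := hx'.trans_le hxs
    have h1 := mul_log_sub_log_le hx (b := Real.sqrt x * Real.sqrt s) (by positivity)
      fun h => absurd h (by positivity)
    rw [Real.log_mul (by positivity) (by positivity), Real.log_sqrt hx, Real.log_sqrt hs.le] at h1
    rw [Real.log_div hx'.ne' hs.ne']
    nlinarith
  have h1 := key a (a + b) ha (by linarith)
  have h2 := key b (a + b) hb (by linarith)
  unfold bhattaUnc
  rw [Real.sqrt_mul ha]
  have e1 := Real.sq_sqrt ha
  have e2 := Real.sq_sqrt hb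
  have e3 := Real.sq_sqrt (add_nonneg ha hb)
  have n1 := Real.sqrt_nonneg a
  have n2 := Real.sqrt_nonneg b
  -- After squaring, the two sides differ by exactly ab.
  have h3 : (Real.sqrt a + Real.sqrt b) * Real.sqrt (a + b) ≤
      a + b + Real.sqrt a * Real.sqrt b := by
    refine abs_le_of_sq_le_sq' ?_ (by positivity) |>.2
    rw [mul_pow, e3]
    nlinarith [mul_nonneg n1 n2, sq_nonneg (Real.sqrt a * Real.sqrt b)]
  nlinarith

theorem sub_entropyUnc_le {a b : ℝ} (ha : 0 ≤ a) (hb : 0 ≤ b) :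
    a + b - entropyUnc a b ≤ (a + b - quadUnc a b) / Real.log 2 := by
  have hl : 0 < Real.log 2 := Real.log_pos one_lt_two
  rw [quadUnc_eq ha hb, le_div_iff₀ hl]
  have h0 : (a + b - entropyUnc a b) * Real.log 2 =
      (a + b) * Real.log 2 + (a * Real.log (a / (a + b)) + b * Real.log (b / (a + b))) := by
    unfold entropyUnc Real.logb
    field_simp
    ring
  rw [h0]
  rcases (add_nonneg ha hb).eq_or_lt with h | h
  · obtain rfl : a = 0 := by linarith
    obtain rfl : b = 0 := by linarith
    simp
  have key : ∀ x s : ℝ, 0 ≤ x → 0 < s →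
      x * (Real.log 2 + Real.log (x / s)) ≤ x * (2 * x / s - 1) := by
    intro x s hx hs
    rcases hx.eq_or_lt with rfl | hx'
    · simp
    refine mul_le_mul_of_nonneg_left ?_ hx
    rw [← Real.log_mul two_ne_zero (by positivity), ← mul_div_assoc]
    exact Real.log_le_sub_one_of_pos (by positivity)
  have h1 := key a _ ha h
  have h2 := key b _ hb h
  have h3 : a * (2 * a / (a + b) - 1) + b * (2 * b / (a + b) - 1) =
      a + b - (a + b - (a - b) ^ 2 / (a + b)) := by
    field_simp; ring
  linarith

theorem log_two_mul_condUnc_entropyUnc_le {p : Ω → ℝ} (hp : ∀ ω, 0 ≤ p ω) (X : Ω → ZMod 2)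
    (V : Ω → T) : Real.log 2 * condUnc entropyUnc p X V ≤ condUnc bhattaUnc p X V := by
  unfold condUnc
  rw [Finset.mul_sum]
  exact Finset.sum_le_sum fun v _ =>
    log_two_mul_entropyUnc_le (probOf_nonneg hp _) (probOf_nonneg hp _)

theorem one_sub_condUnc_entropyUnc_le {p : Ω → ℝ} (hp : ∀ ω, 0 ≤ p ω) (hp1 : ∑ ω, p ω = 1)
    (X : Ω → ZMod 2) (V : Ω → T) :
    1 - condUnc entropyUnc p X V ≤ (1 - condUnc quadUnc p X V) / Real.log 2 := by
  unfold condUnc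
  rw [← sum_probOf_bit hp1 X V, ← Finset.sum_sub_distrib, ← Finset.sum_sub_distrib,
    Finset.sum_div]
  exact Finset.sum_le_sum fun v _ => sub_entropyUnc_le (probOf_nonneg hp _) (probOf_nonneg hp _)

/-- Cauchy–Schwarz over the cells: the square of each Bhattacharyya term is the quadratic term times
the cell's mass, and the masses sum to one. -/
theorem condUnc_bhattaUnc_sq_le {p : Ω → ℝ} (hp : ∀ ω, 0 ≤ p ω) (hp1 : ∑ ω, p ω = 1)
    (X : Ω → ZMod 2) (V : Ω → T) :
    condUnc bhattaUnc p X V ^ 2 ≤ condUnc quadUnc p X V := by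
  have n : ∀ x v, 0 ≤ probOf p (fun ω => X ω = x ∧ V ω = v) := fun x v => probOf_nonneg hp _
  have h := Finset.sum_sq_le_sum_mul_sum_of_sq_le_mul (Finset.univ : Finset T)
    (r := fun v => bhattaUnc (probOf p fun ω => X ω = 0 ∧ V ω = v)
      (probOf p fun ω => X ω = 1 ∧ V ω = v))
    (f := fun v => quadUnc (probOf p fun ω => X ω = 0 ∧ V ω = v)
      (probOf p fun ω => X ω = 1 ∧ V ω = v))
    (g := fun v => probOf p (fun ω => X ω = 0 ∧ V ω = v) + probOf p (fun ω => X ω = 1 ∧ V ω = v))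
    (fun v _ => by have h0 := n 0 v; have h1 := n 1 v; unfold quadUnc; positivity)
    (fun v _ => add_nonneg (n 0 v) (n 1 v)) (fun v _ => le_of_eq ?_)
  · rw [sum_probOf_bit hp1, mul_one] at h
    exact h
  · have h0 := n 0 v
    have h1 := n 1 v
    generalize probOf p (fun ω => X ω = 0 ∧ V ω = v) = a at *
    generalize probOf p (fun ω => X ω = 1 ∧ V ω = v) = b at *
    rw [bhattaUnc, mul_pow, Real.sq_sqrt (mul_nonneg h0 h1), quadUnc]
    rcases (add_nonneg h0 h1).eq_or_lt with h | h
    · obtain rfl : a = 0 := by linarith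
      simp
    · field_simp; ring

theorem condUnc_quadUnc_nonneg {p : Ω → ℝ} (hp : ∀ ω, 0 ≤ p ω) (X : Ω → ZMod 2) (V : Ω → T) :
    0 ≤ condUnc quadUnc p X V := by
  refine Finset.sum_nonneg fun v _ => ?_
  have h0 := probOf_nonneg hp fun ω => X ω = 0 ∧ V ω = v
  have h1 := probOf_nonneg hp fun ω => X ω = 1 ∧ V ω = v
  unfold quadUnc
  positivity

theorem condUnc_bhattaUnc_nonneg (p : Ω → ℝ) (X : Ω → ZMod 2) (V : Ω → T) :
    0 ≤ condUnc bhattaUnc p X V :=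
  Finset.sum_nonneg fun v _ => by unfold bhattaUnc; positivity

theorem condUnc_quadUnc_le_one {p : Ω → ℝ} (hp : ∀ ω, 0 ≤ p ω) (hp1 : ∑ ω, p ω = 1)
    (X : Ω → ZMod 2) (V : Ω → T) : condUnc quadUnc p X V ≤ 1 := by
  rw [← sub_nonneg, one_sub_condUnc_quadUnc hp hp1]
  refine Finset.sum_nonneg fun v _ => div_nonneg (sq_nonneg _) ?_
  exact add_nonneg (probOf_nonneg hp _) (probOf_nonneg hp _)

theorem condUnc_entropyUnc_mem_Icc {p : Ω → ℝ} (hp : ∀ ω, 0 ≤ p ω) (hp1 : ∑ ω, p ω = 1)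
    (X : Ω → ZMod 2) (V : Ω → T) : condUnc entropyUnc p X V ∈ Set.Icc 0 1 := by
  have hl : 0 < Real.log 2 := Real.log_pos one_lt_two
  constructor
  · refine Finset.sum_nonneg fun v _ => ?_
    have key : ∀ x s : ℝ, 0 ≤ x → x ≤ s → x * Real.logb 2 (x / s) ≤ 0 := fun x s hx hxs =>
      mul_nonpos_of_nonneg_of_nonpos hx
        (Real.logb_nonpos one_lt_two (div_nonneg hx (hx.trans hxs))
          (div_le_one_of_le₀ hxs (hx.trans hxs)))
    have h0 := probOf_nonneg hp fun ω => X ω = 0 ∧ V ω = v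
    have h1 := probOf_nonneg hp fun ω => X ω = 1 ∧ V ω = v
    have := key _ _ h0 (le_add_of_nonneg_right h1)
    have := key _ _ h1 (le_add_of_nonneg_left h0)
    unfold entropyUnc
    linarith
  · rw [← sum_probOf_bit hp1 X V]
    refine Finset.sum_le_sum fun v _ => ?_
    have h0 := probOf_nonneg hp fun ω => X ω = 0 ∧ V ω = v
    have h1 := probOf_nonneg hp fun ω => X ω = 1 ∧ V ω = v
    generalize probOf p (fun ω => X ω = 0 ∧ V ω = v) = a at *
    generalize probOf p (fun ω => X ω = 1 ∧ V ω = v) = b at *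
    have h := log_sum_le h0 h1 (le_add_of_nonneg_right h1) (le_add_of_nonneg_left h0)
    rcases (add_nonneg h0 h1).eq_or_lt with h' | h'
    · obtain rfl : a = 0 := by linarith
      obtain rfl : b = 0 := by linarith
      simp [entropyUnc]
    have h2 : (a + b) / (a + b + (a + b)) = 2⁻¹ := by field_simp; norm_num
    rw [h2, Real.log_inv] at h
    have h3 : entropyUnc a b =
        -(a * Real.log (a / (a + b)) + b * Real.log (b / (a + b))) / Real.log 2 := by
      unfold entropyUnc Real.logb
      field_simp
    rw [h3, div_le_iff₀ hl]
    linarith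

end Measures

variable {𝒴 : Type*} [Fintype 𝒴]

/-! ### The uncertainty of an information bit -/

/-- The channel outputs together with the information bits indexed by `S`. -/
def observed {m : ℕ} (S : Set (Finset (Fin m))) (ω : Sample 𝒴 m) :
    (Cube m → 𝒴) × (Finset (Fin m) → ZMod 2) :=
  open Classical in (ω.2, fun B => if B ∈ S then ω.1 B else 0)

/-- Bits outside `S` are masked by the constant 0, so all `S` share one observation type while
equality of observations still constrains exactly the bits in `S`. -/
theorem observed_eq_iff {𝒴 : Type*} {m : ℕ} {S : Set (Finset (Fin m))} {ω ω' : Sample 𝒴 m} :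
    observed S ω = observed S ω' ↔ ω.2 = ω'.2 ∧ ∀ B ∈ S, ω.1 B = ω'.1 B := by
  unfold observed
  rw [Prod.mk.injEq]
  refine and_congr_right fun _ => ⟨fun h B hB => ?_, fun h => funext fun B => ?_⟩
  · have := congrFun h B
    simpa [hB] using this
  · split_ifs with hB
    · exact h B hB
    · rfl

/-- The uncertainty of the bit `U_A` given the outputs and the bits indexed by `S`. -/
def bitUnc (f : ℝ → ℝ → ℝ) (W : BinaryChannel 𝒴) (m : ℕ) (A : Finset (Fin m))
    (S : Set (Finset (Fin m))) : ℝ :=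
  condUnc f (jointLaw W m) (fun ω => ω.1 A) (observed S)

/-- The uncertainty of the bit `U_A` given the outputs and the bits preceding it. -/
def uncAt (f : ℝ → ℝ → ℝ) (W : BinaryChannel 𝒴) (m : ℕ) (A : Finset (Fin m)) : ℝ :=
  bitUnc f W m A {B | setLT B A}

theorem entropyAt_eq_uncAt (W : BinaryChannel 𝒴) (m : ℕ) (A : Finset (Fin m)) :
    entropyAt W m A = uncAt entropyUnc W m A := by
  rw [uncAt, bitUnc, ← condEntropy_eq_condUnc]
  refine condEntropy_congr _ (fun _ _ => Iff.rfl) fun ω ω' => ?_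
  rw [observed_eq_iff, Prod.mk.injEq]
  refine and_congr_right fun _ => ⟨fun h B hB => congrFun h ⟨B, hB⟩, fun h => ?_⟩
  exact funext fun B => h B.1 B.2

theorem BinaryChannel.blockProb_nonneg (W : BinaryChannel 𝒴) {m : ℕ} (x : Word m)
    (y : Cube m → 𝒴) : 0 ≤ W.blockProb x y :=
  Finset.prod_nonneg fun _ _ => W.prob_nonneg _ _

theorem BinaryChannel.sum_blockProb (W : BinaryChannel 𝒴) {m : ℕ} (x : Word m) :
    ∑ y, W.blockProb x y = 1 := by
  classical
  have h := Finset.prod_univ_sum (fun _ : Cube m => (Finset.univ : Finset 𝒴))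
    fun z y => W.prob (x z) y
  rw [Fintype.piFinset_univ] at h
  unfold blockProb
  rw [← h]
  exact Finset.prod_eq_one fun z _ => W.sum_prob _

theorem jointLaw_nonneg (W : BinaryChannel 𝒴) (m : ℕ) (ω : Sample 𝒴 m) : 0 ≤ jointLaw W m ω :=
  mul_nonneg (by positivity) (W.blockProb_nonneg _ _)

theorem sum_jointLaw (W : BinaryChannel 𝒴) (m : ℕ) : ∑ ω, jointLaw W m ω = 1 := by
  unfold jointLaw
  rw [Fintype.sum_prod_type]
  simp only [← Finset.mul_sum, W.sum_blockProb, Finset.sum_const, Finset.card_univ]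
  simp only [Fintype.card_fun, Fintype.card_finset, ZMod.card, Fintype.card_fin]
  simp

/-! ### Permutations of the coordinates -/

/-- Relabelling of a sample by a permutation of the coordinates. -/
def permSample (𝒴 : Type*) {m : ℕ} (σ : Equiv.Perm (Fin m)) : Sample 𝒴 m ≃ Sample 𝒴 m :=
  (Equiv.arrowCongr σ.symm.finsetCongr (Equiv.refl (ZMod 2))).prodCongr
    (Equiv.arrowCongr (Equiv.arrowCongr σ.symm (Equiv.refl (ZMod 2))) (Equiv.refl 𝒴))

theorem permSample_fst {𝒴 : Type*} {m : ℕ} (σ : Equiv.Perm (Fin m)) (ω : Sample 𝒴 m) (A : Finset (Fin m)) :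
    (permSample 𝒴 σ ω).1 A = ω.1 (A.map σ.toEmbedding) := rfl

theorem permSample_snd {𝒴 : Type*} {m : ℕ} (σ : Equiv.Perm (Fin m)) (ω : Sample 𝒴 m) (z : Cube m) :
    (permSample 𝒴 σ ω).2 z = ω.2 (z ∘ σ.symm) := rfl

/-- Renaming coordinates permutes the monomials and the points of the cube compatibly, and the uses
of the channel are identically distributed. -/
theorem jointLaw_permSample (W : BinaryChannel 𝒴) {m : ℕ} (σ : Equiv.Perm (Fin m))
    (ω : Sample 𝒴 m) : jointLaw W m (permSample 𝒴 σ ω) = jointLaw W m ω := by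
  have henc : ∀ z, encode m (permSample 𝒴 σ ω).1 z = encode m ω.1 (z ∘ σ.symm) := by
    intro z
    unfold encode
    rw [Finset.sum_apply, Finset.sum_apply, ← Equiv.sum_comp σ.finsetCongr
      fun A => (ω.1 A • monomialVec m A) (z ∘ σ.symm)]
    refine Finset.sum_congr rfl fun A _ => ?_
    rw [Pi.smul_apply, Pi.smul_apply, permSample_fst, Equiv.finsetCongr_apply, monomialVec,
      monomialVec, Finset.prod_map]
    simp
  unfold jointLaw BinaryChannel.blockProb
  congr 1
  rw [← Equiv.prod_comp (Equiv.arrowCongr σ (Equiv.refl (ZMod 2))) fun z =>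
    W.prob (encode m ω.1 z) (ω.2 z)]
  refine Finset.prod_congr rfl fun z _ => ?_
  rw [henc, permSample_snd]
  rfl

theorem bitUnc_map_perm {f : ℝ → ℝ → ℝ} (hf : IsUncertainty f) (W : BinaryChannel 𝒴) {m : ℕ}
    (σ : Equiv.Perm (Fin m)) (A : Finset (Fin m)) {S S' : Set (Finset (Fin m))}
    (h : ∀ B ∈ S', B.map σ.toEmbedding ∈ S) :
    bitUnc f W m (A.map σ.toEmbedding) S ≤ bitUnc f W m A S' := by
  unfold bitUnc
  rw [← condUnc_comp_equiv f (permSample 𝒴 σ) (jointLaw W m) (fun ω => ω.1 A)]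
  simp only [jointLaw_permSample, permSample_fst]
  refine condUnc_le_of_finer hf (jointLaw_nonneg W m) _ _ _ fun ω ω' hω => ?_
  rw [observed_eq_iff] at hω ⊢
  refine ⟨funext fun z => ?_, fun B hB => ?_⟩
  · rw [permSample_snd, permSample_snd, hω.1]
  · rw [permSample_fst, permSample_fst]
    exact hω.2 _ (h B hB)

theorem exists_perm_map_eq {m : ℕ} {A B : Finset (Fin m)} (h : A.card = B.card) :
    ∃ σ : Equiv.Perm (Fin m), A.map σ.toEmbedding = B := by
  classical
  let e : {x // x ∈ A} ≃ {x // x ∈ B} := Finset.equivOfCardEq h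
  refine ⟨e.extendSubtype, Finset.eq_of_subset_of_card_le (fun b hb => ?_) (by simp [h])⟩
  obtain ⟨a, ha, rfl⟩ := Finset.mem_map.1 hb
  exact e.extendSubtype_mem a ha

theorem card_firstSet {m i : ℕ} (h : i ≤ m) : (firstSet m i).card = i := by
  have : firstSet m i = Finset.univ.map (Fin.castLEEmb h) := by
    ext j
    simp only [firstSet, Finset.mem_filter, Finset.mem_univ, true_and, Finset.mem_map,
      Fin.castLEEmb_apply]
    exact ⟨fun hj => ⟨⟨j, hj⟩, rfl⟩, by rintro ⟨k, rfl⟩; exact k.2⟩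
  rw [this]; simp

theorem card_lastSet {m i : ℕ} (h : i ≤ m) : (lastSet m i).card = i := by
  have : lastSet m i = (firstSet m (m - i))ᶜ := by
    ext j
    simp only [lastSet, firstSet, Finset.mem_filter, Finset.mem_univ, true_and, Finset.mem_compl]
    omega
  rw [this, Finset.card_compl, card_firstSet (by omega), Fintype.card_fin]
  omega

theorem exists_mem_sdiff_of_card_eq {m : ℕ} {A B : Finset (Fin m)} (h : A.card = B.card)
    {a : Fin m} (ha : a ∈ A) (hb : a ∉ B) : ∃ b ∈ B, b ∉ A := by
  by_contra! hc
  have : B = A := Finset.eq_of_subset_of_card_le hc h.le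
  exact hb (this ▸ ha)

theorem firstSet_le {m : ℕ} {A : Finset (Fin m)} :
    toColex (firstSet m A.card) ≤ toColex A := by
  rw [Finset.Colex.toColex_le_toColex]
  intro a ha hA
  have hc : (firstSet m A.card).card = A.card := card_firstSet (by simpa using A.card_le_univ)
  obtain ⟨b, hb, hb'⟩ := exists_mem_sdiff_of_card_eq hc ha hA
  refine ⟨b, hb, hb', ?_⟩
  simp only [firstSet, Finset.mem_filter, Finset.mem_univ, true_and] at ha hb'
  rw [Fin.le_def]; omega

theorem le_lastSet {m : ℕ} {A : Finset (Fin m)} :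
    toColex A ≤ toColex (lastSet m A.card) := by
  rw [Finset.Colex.toColex_le_toColex]
  intro a ha hA
  have hc : (lastSet m A.card).card = A.card := card_lastSet (by simpa using A.card_le_univ)
  obtain ⟨b, hb, hb'⟩ := exists_mem_sdiff_of_card_eq hc.symm ha hA
  refine ⟨b, hb, hb', ?_⟩
  simp only [lastSet, Finset.mem_filter, Finset.mem_univ, true_and] at hA hb
  rw [Fin.le_def]; omega

/-- Among the sets of a given size, the initial segment has the most uncertain bit. -/
theorem uncAt_le_firstSet {f : ℝ → ℝ → ℝ} (hf : IsUncertainty f) (W : BinaryChannel 𝒴) {m : ℕ}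
    (A : Finset (Fin m)) : uncAt f W m A ≤ uncAt f W m (firstSet m A.card) := by
  have hc : (firstSet m A.card).card = A.card := card_firstSet (by simpa using A.card_le_univ)
  obtain ⟨σ, hσ⟩ := exists_perm_map_eq hc
  unfold uncAt
  conv_lhs => rw [← hσ]
  refine bitUnc_map_perm hf W σ _ fun B hB => ?_
  rw [hσ]
  -- Nothing on the same level precedes the initial segment, so all its predecessors are larger
  -- sets, and their images under σ are too.
  rcases hB with hB | ⟨hB, hB'⟩
  · left; rwa [Finset.card_map, ← hc]
  · refine absurd hB' (not_lt_of_ge ?_)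
    have h2 : A.card = B.card := by rw [hB, hc]
    rw [h2]; exact firstSet_le

/-- Among the sets of a given size, the final segment has the least uncertain bit. -/
theorem lastSet_le_uncAt {f : ℝ → ℝ → ℝ} (hf : IsUncertainty f) (W : BinaryChannel 𝒴) {m : ℕ}
    (A : Finset (Fin m)) : uncAt f W m (lastSet m A.card) ≤ uncAt f W m A := by
  have hc : (lastSet m A.card).card = A.card := card_lastSet (by simpa using A.card_le_univ)
  obtain ⟨σ, hσ⟩ := exists_perm_map_eq hc.symm
  unfold uncAt
  rw [← hσ]
  refine bitUnc_map_perm hf W σ _ fun B hB => ?_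
  rw [hσ]
  rcases hB with hB | ⟨hB, hB'⟩
  · left; rwa [Finset.card_map, hc]
  -- The final segment is the greatest of its level, so the image of a predecessor on that level
  -- precedes it as soon as it differs from it.
  · right
    refine ⟨by rw [Finset.card_map, hc, hB], lt_of_le_of_ne ?_ fun he => ?_⟩
    · have := le_lastSet (A := B.map σ.toEmbedding)
      rwa [Finset.card_map, hB] at this
    · have he' : B.map σ.toEmbedding = A.map σ.toEmbedding := by
        rw [hσ]; exact he
      rw [Finset.map_inj.1 he'] at hB'
      exact lt_irrefl _ hB'

/-! ### Splitting off a coordinate -/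

/-- The subset of `[m + 1] \ {j}` corresponding to `A ⊆ [m]`. -/
def liftSet {m : ℕ} (j : Fin (m + 1)) (A : Finset (Fin m)) : Finset (Fin (m + 1)) :=
  A.map (Fin.succAboveEmb j)

theorem notMem_liftSet {m : ℕ} (j : Fin (m + 1)) (A : Finset (Fin m)) : j ∉ liftSet j A := by
  simp [liftSet, Fin.succAbove_ne]

theorem card_liftSet {m : ℕ} (j : Fin (m + 1)) (A : Finset (Fin m)) :
    (liftSet j A).card = A.card := Finset.card_map _

theorem card_insert_liftSet {m : ℕ} (j : Fin (m + 1)) (A : Finset (Fin m)) :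
    (insert j (liftSet j A)).card = A.card + 1 := by
  rw [Finset.card_insert_of_notMem (notMem_liftSet j A), card_liftSet]

theorem exists_eq_liftSet {m : ℕ} (j : Fin (m + 1)) {C : Finset (Fin (m + 1))} (h : j ∉ C) :
    ∃ A, C = liftSet j A := by
  refine ⟨Finset.univ.filter fun i => j.succAbove i ∈ C, ?_⟩
  ext k
  simp only [liftSet, Finset.mem_map, Finset.mem_filter, Finset.mem_univ, true_and,
    Fin.coe_succAboveEmb]
  constructor
  · intro hk
    obtain ⟨i, rfl⟩ := Fin.exists_succAbove_eq (x := k) (y := j) fun h' => h (h' ▸ hk)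
    exact ⟨i, hk, rfl⟩
  · rintro ⟨i, hi, rfl⟩; exact hi

theorem exists_eq_insert_liftSet {m : ℕ} (j : Fin (m + 1)) {C : Finset (Fin (m + 1))}
    (h : j ∈ C) : ∃ A, C = insert j (liftSet j A) := by
  obtain ⟨A, hA⟩ := exists_eq_liftSet j (Finset.notMem_erase j C)
  exact ⟨A, by rw [← hA, Finset.insert_erase h]⟩

theorem sum_finset_succ {M : Type*} [AddCommMonoid M] {m : ℕ} (j : Fin (m + 1))
    (g : Finset (Fin (m + 1)) → M) :
    ∑ C, g C = ∑ A, (g (liftSet j A) + g (insert j (liftSet j A))) := by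
  have hu : (Finset.univ : Finset (Finset (Fin (m + 1)))) =
      (insert j (Finset.univ.map (Fin.succAboveEmb j))).powerset := by
    rw [← Finset.powerset_univ]
    congr 1
    ext k
    rcases eq_or_ne k j with rfl | hk
    · simp
    · obtain ⟨i, rfl⟩ := Fin.exists_succAbove_eq hk
      simp
  have hb : ∀ g' : Finset (Fin (m + 1)) → M,
      ∑ C ∈ (Finset.univ.map (Fin.succAboveEmb j)).powerset, g' C = ∑ A, g' (liftSet j A) := by
    intro g'
    symm
    refine Finset.sum_nbij (liftSet j) (fun A _ => ?_) (fun A _ B _ h => ?_) (fun C hC => ?_)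
      fun _ _ => rfl
    · rw [Finset.mem_powerset]
      exact Finset.map_subset_map.2 (Finset.subset_univ A)
    · exact Finset.map_injective _ h
    · obtain ⟨A, -, hA⟩ := Finset.subset_map_iff.1 (Finset.mem_powerset.1 hC)
      exact ⟨A, Finset.mem_coe.2 (Finset.mem_univ _), hA.symm⟩
  rw [hu, Finset.sum_powerset_insert (by simp [Fin.succAbove_ne]), hb, hb,
    Finset.sum_add_distrib]

/-- The point of the cube with `j`-th coordinate `b` and remaining coordinates `z`. -/
def liftPoint {m : ℕ} (j : Fin (m + 1)) (b : ZMod 2) (z : Cube m) : Cube (m + 1) :=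
  Fin.insertNthEquiv (fun _ => ZMod 2) j (b, z)

theorem prod_liftPoint_liftSet {m : ℕ} (j : Fin (m + 1)) (b : ZMod 2) (z : Cube m)
    (A : Finset (Fin m)) : monomialVec (m + 1) (liftSet j A) (liftPoint j b z) =
      monomialVec m A z := by
  simp [monomialVec, liftSet, liftPoint]

theorem prod_liftPoint_insert_liftSet {m : ℕ} (j : Fin (m + 1)) (b : ZMod 2) (z : Cube m)
    (A : Finset (Fin m)) : monomialVec (m + 1) (insert j (liftSet j A)) (liftPoint j b z) =
      b * monomialVec m A z := by
  rw [← prod_liftPoint_liftSet j b z A, monomialVec, Finset.prod_insert (notMem_liftSet j A)]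
  simp [monomialVec, liftPoint]

/-- The Plotkin (u | u + v) decomposition: the restriction of a polynomial to a face of the cube is
again a polynomial in the remaining variables. -/
theorem encode_liftPoint {m : ℕ} (j : Fin (m + 1)) (b : ZMod 2) (z : Cube m)
    (u : Finset (Fin (m + 1)) → ZMod 2) : encode (m + 1) u (liftPoint j b z) =
      encode m (fun A => u (liftSet j A) + b * u (insert j (liftSet j A))) z := by
  unfold encode
  rw [Finset.sum_apply, Finset.sum_apply, sum_finset_succ j]
  refine Finset.sum_congr rfl fun A _ => ?_
  simp only [Pi.smul_apply, smul_eq_mul, prod_liftPoint_liftSet, prod_liftPoint_insert_liftSet]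
  ring

/-- The two samples of length `2 ^ m` obtained by fixing the `j`-th coordinate. -/
def splitFun {m : ℕ} (j : Fin (m + 1)) (ω : Sample 𝒴 (m + 1)) : Sample 𝒴 m × Sample 𝒴 m :=
  ((fun A => ω.1 (liftSet j A), fun z => ω.2 (liftPoint j 0 z)),
    (fun A => ω.1 (liftSet j A) + ω.1 (insert j (liftSet j A)), fun z => ω.2 (liftPoint j 1 z)))

theorem splitFun_injective {𝒴 : Type*} {m : ℕ} (j : Fin (m + 1)) :
    Function.Injective (splitFun (𝒴 := 𝒴) j) := by
  intro ω ω' h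
  simp only [splitFun, Prod.mk.injEq] at h
  obtain ⟨⟨h1, h2⟩, h3, h4⟩ := h
  refine Prod.ext (funext fun C => ?_) (funext fun z => ?_)
  · by_cases hj : j ∈ C
    · obtain ⟨A, rfl⟩ := exists_eq_insert_liftSet j hj
      have h5 := congrFun h3 A
      have h6 := congrFun h1 A
      rwa [h6, add_right_inj] at h5
    · obtain ⟨A, rfl⟩ := exists_eq_liftSet j hj
      exact congrFun h1 A
  · obtain ⟨⟨b, z⟩, rfl⟩ := (Fin.insertNthEquiv (fun _ => ZMod 2) j).surjective z
    have hb : b = 0 ∨ b = 1 := by revert b; decide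
    rcases hb with rfl | rfl
    · exact congrFun h2 z
    · exact congrFun h4 z

/-- Splitting a sample along the `j`-th coordinate is a bijection. -/
def splitEquiv (𝒴 : Type*) [Fintype 𝒴] {m : ℕ} (j : Fin (m + 1)) :
    Sample 𝒴 (m + 1) ≃ Sample 𝒴 m × Sample 𝒴 m :=
  Equiv.ofBijective (splitFun j) <| by
    classical
    rw [Fintype.bijective_iff_injective_and_card]
    refine ⟨splitFun_injective j, ?_⟩
    simp only [Fintype.card_prod, Fintype.card_fun, Fintype.card_finset, ZMod.card,
      Fintype.card_fin]
    ring

theorem jointLaw_splitEquiv (W : BinaryChannel 𝒴) {m : ℕ} (j : Fin (m + 1))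
    (ω : Sample 𝒴 (m + 1)) :
    jointLaw W m (splitEquiv 𝒴 j ω).1 * jointLaw W m (splitEquiv 𝒴 j ω).2 =
      jointLaw W (m + 1) ω := by
  have hprod : W.blockProb (encode (m + 1) ω.1) ω.2 =
      W.blockProb (encode m (splitFun j ω).1.1) (splitFun j ω).1.2 *
      W.blockProb (encode m (splitFun j ω).2.1) (splitFun j ω).2.2 := by
    unfold BinaryChannel.blockProb
    rw [← Equiv.prod_comp (Fin.insertNthEquiv (fun _ => ZMod 2) j), Fintype.prod_prod_type,
      prod_zmod_two]
    have h := encode_liftPoint j (u := ω.1)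
    simp only [liftPoint] at h
    simp only [h, splitFun, zero_mul, add_zero, one_mul, liftPoint]
  change jointLaw W m (splitFun j ω).1 * jointLaw W m (splitFun j ω).2 = _
  unfold jointLaw
  rw [hprod]
  ring

theorem liftSet_colex {m : ℕ} (j : Fin (m + 1)) {A B : Finset (Fin m)} :
    toColex (liftSet j A) < toColex (liftSet j B) ↔ toColex A < toColex B := by
  unfold liftSet
  rw [Finset.map_eq_image, Finset.map_eq_image]
  exact Finset.Colex.toColex_image_lt_toColex_image (Fin.strictMono_succAbove j)

theorem setLT_liftSet {m : ℕ} (j : Fin (m + 1)) {A B : Finset (Fin m)} :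
    setLT (liftSet j B) (liftSet j A) ↔ setLT B A := by
  simp only [setLT, card_liftSet, liftSet_colex]

theorem setLT_insert_liftSet {m : ℕ} (j : Fin (m + 1)) {A B : Finset (Fin m)} :
    setLT (insert j (liftSet j B)) (insert j (liftSet j A)) ↔ setLT B A := by
  have h : toColex (insert j (liftSet j B)) < toColex (insert j (liftSet j A)) ↔
      toColex (liftSet j B) < toColex (liftSet j A) := by
    rw [← Finset.Colex.toColex_sdiff_lt_toColex_sdiff (u := {j}) (by simp) (by simp),
      Finset.sdiff_singleton_eq_erase, Finset.sdiff_singleton_eq_erase,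
      Finset.erase_insert (notMem_liftSet j B), Finset.erase_insert (notMem_liftSet j A)]
  simp only [setLT, card_insert_liftSet, add_lt_add_iff_right, add_left_inj, h, liftSet_colex]

/-- Before the lifted `A` come the lifts of all `B` < `A` and, being larger, the sets `insert j
(liftSet j B)` with |B| ≥ |A|. This determines the earlier bits of both halves and, taking `B` =
`A`, the sum of the two halves' bits at `A`. -/
theorem uncAt_liftSet_le_plus {f : ℝ → ℝ → ℝ} (hf : IsUncertainty f) (W : BinaryChannel 𝒴)
    {m : ℕ} (j : Fin (m + 1)) (A : Finset (Fin m)) :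
    uncAt f W (m + 1) (liftSet j A) ≤
      condUnc f (fun ω : Sample 𝒴 m × Sample 𝒴 m => jointLaw W m ω.1 * jointLaw W m ω.2)
        (fun ω => ω.1.1 A)
        (fun ω => ((observed {B | setLT B A} ω.1, observed {B | setLT B A} ω.2),
          ω.1.1 A + ω.2.1 A)) := by
  rw [← condUnc_comp_equiv f (splitEquiv 𝒴 j)]
  simp only [jointLaw_splitEquiv]
  refine condUnc_le_of_finer hf (jointLaw_nonneg W _) (fun ω => ω.1 (liftSet j A)) _ _
    fun ω ω' h => ?_
  rw [observed_eq_iff] at h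
  obtain ⟨hy, hu⟩ := h
  have hins : ∀ B : Finset (Fin m), A.card ≤ B.card →
      ω.1 (insert j (liftSet j B)) = ω'.1 (insert j (liftSet j B)) := fun B hB => by
    refine hu _ (Or.inl ?_)
    rw [card_liftSet, card_insert_liftSet]
    omega
  have hlift : ∀ B, setLT B A → ω.1 (liftSet j B) = ω'.1 (liftSet j B) := fun B hB =>
    hu _ ((setLT_liftSet j).2 hB)
  have hcard : ∀ B, setLT B A → A.card ≤ B.card := fun B hB => by
    rcases hB with hB | hB
    · exact hB.le
    · exact hB.1.ge
  rw [Prod.mk.injEq, Prod.mk.injEq, observed_eq_iff, observed_eq_iff]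
  change ((_ ∧ ∀ B ∈ {B | setLT B A}, ω.1 (liftSet j B) = ω'.1 (liftSet j B)) ∧
    (_ ∧ ∀ B ∈ {B | setLT B A}, ω.1 (liftSet j B) + ω.1 (insert j (liftSet j B)) =
      ω'.1 (liftSet j B) + ω'.1 (insert j (liftSet j B)))) ∧
    ω.1 (liftSet j A) + (ω.1 (liftSet j A) + ω.1 (insert j (liftSet j A))) =
    ω'.1 (liftSet j A) + (ω'.1 (liftSet j A) + ω'.1 (insert j (liftSet j A)))
  refine ⟨⟨⟨funext fun z => congrFun hy _, hlift⟩, ⟨funext fun z => congrFun hy _, fun B hB => ?_⟩⟩,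
    ?_⟩
  · rw [hlift B hB, hins B (hcard B hB)]
  · have h2 : ∀ a b : ZMod 2, a + (a + b) = b := by decide
    rw [h2, h2, hins A le_rfl]

/-- The sum of the two halves' bits at `A` is the bit of `insert j (liftSet j A)`. Its predecessors
are of the form `insert j (liftSet j B)` or `liftSet j B` with `B` < `A` in both cases (in the
second, |B| > |A|), so the halves' earlier bits determine them all. -/
theorem minus_le_uncAt_insert {f : ℝ → ℝ → ℝ} (hf : IsUncertainty f) (W : BinaryChannel 𝒴)
    {m : ℕ} (j : Fin (m + 1)) (A : Finset (Fin m)) :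
    condUnc f (fun ω : Sample 𝒴 m × Sample 𝒴 m => jointLaw W m ω.1 * jointLaw W m ω.2)
        (fun ω => ω.1.1 A + ω.2.1 A)
        (fun ω => (observed {B | setLT B A} ω.1, observed {B | setLT B A} ω.2)) ≤
      uncAt f W (m + 1) (insert j (liftSet j A)) := by
  rw [← condUnc_comp_equiv f (splitEquiv 𝒴 j)]
  simp only [jointLaw_splitEquiv]
  have hX : ∀ ω : Sample 𝒴 (m + 1), (splitEquiv 𝒴 j ω).1.1 A + (splitEquiv 𝒴 j ω).2.1 A =
      ω.1 (insert j (liftSet j A)) := by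
    intro ω
    change ω.1 (liftSet j A) + (ω.1 (liftSet j A) + ω.1 (insert j (liftSet j A))) = _
    have h2 : ∀ a b : ZMod 2, a + (a + b) = b := by decide
    rw [h2]
  simp only [hX]
  refine condUnc_le_of_finer hf (jointLaw_nonneg W _) _ _ _ fun ω ω' h => ?_
  rw [Prod.mk.injEq, observed_eq_iff, observed_eq_iff] at h
  obtain ⟨⟨hy0, hu0⟩, hy1, hu1⟩ := h
  change ∀ B ∈ {B | setLT B A}, ω.1 (liftSet j B) = ω'.1 (liftSet j B) at hu0
  change ∀ B ∈ {B | setLT B A}, ω.1 (liftSet j B) + ω.1 (insert j (liftSet j B)) =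
      ω'.1 (liftSet j B) + ω'.1 (insert j (liftSet j B)) at hu1
  rw [observed_eq_iff]
  refine ⟨funext fun z => ?_, fun C hC => ?_⟩
  · obtain ⟨⟨b, z⟩, rfl⟩ := (Fin.insertNthEquiv (fun _ => ZMod 2) j).surjective z
    have hb : b = 0 ∨ b = 1 := by revert b; decide
    rcases hb with rfl | rfl
    · exact congrFun hy0 z
    · exact congrFun hy1 z
  · by_cases hj : j ∈ C
    · obtain ⟨B, rfl⟩ := exists_eq_insert_liftSet j hj
      have hB : setLT B A := (setLT_insert_liftSet j).1 hC
      have := hu1 B hB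
      rwa [hu0 B hB, add_right_inj] at this
    · obtain ⟨B, rfl⟩ := exists_eq_liftSet j hj
      refine hu0 B (Or.inl ?_)
      rcases hC with hC | hC
      · rw [card_insert_liftSet, card_liftSet] at hC; omega
      · have := hC.1
        rw [card_insert_liftSet, card_liftSet] at this; omega

theorem uncAt_liftSet_le {f : ℝ → ℝ → ℝ} (hf : IsUncertainty f) (W : BinaryChannel 𝒴)
    {m : ℕ} (j : Fin (m + 1)) (A : Finset (Fin m)) :
    uncAt f W (m + 1) (liftSet j A) ≤ uncAt f W m A :=
  (uncAt_liftSet_le_plus hf W j A).trans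
    (plus_le_condUnc hf (jointLaw_nonneg W m) (sum_jointLaw W m) (fun ω => ω.1 A)
      (observed {B | setLT B A}))

theorem le_uncAt_insert_liftSet {f : ℝ → ℝ → ℝ} (hf : IsUncertainty f) (W : BinaryChannel 𝒴)
    {m : ℕ} (j : Fin (m + 1)) (A : Finset (Fin m)) :
    uncAt f W m A ≤ uncAt f W (m + 1) (insert j (liftSet j A)) :=
  (condUnc_le_minus hf (jointLaw_nonneg W m) (sum_jointLaw W m) (fun ω => ω.1 A)
      (observed {B | setLT B A})).trans
    (minus_le_uncAt_insert hf W j A)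

theorem uncAt_bhattaUnc_liftSet_le (W : BinaryChannel 𝒴) {m : ℕ} (j : Fin (m + 1))
    (A : Finset (Fin m)) :
    uncAt bhattaUnc W (m + 1) (liftSet j A) ≤ uncAt bhattaUnc W m A ^ 2 :=
  (uncAt_liftSet_le_plus isUncertainty_bhattaUnc W j A).trans_eq
    (condUnc_bhattaUnc_plus (jointLaw_nonneg W m) (fun ω => ω.1 A) (observed {B | setLT B A}))

theorem one_sub_uncAt_quadUnc_insert_le (W : BinaryChannel 𝒴) {m : ℕ} (j : Fin (m + 1))
    (A : Finset (Fin m)) :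
    1 - uncAt quadUnc W (m + 1) (insert j (liftSet j A)) ≤ (1 - uncAt quadUnc W m A) ^ 2 := by
  have h := minus_le_uncAt_insert isUncertainty_quadUnc W j A
  have h2 := condUnc_quadUnc_minus (jointLaw_nonneg W m) (sum_jointLaw W m) (fun ω => ω.1 A)
    (observed {B | setLT B A})
  unfold uncAt bitUnc at h ⊢
  linarith

/-! ### Monotonicity and polarization -/

/-- Both sides are compared with the same set one dimension lower: "plus" lies below it and "minus"
above. -/
theorem uncAt_le_insert {f : ℝ → ℝ → ℝ} (hf : IsUncertainty f) (W : BinaryChannel 𝒴) {m : ℕ}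
    {j : Fin m} {A : Finset (Fin m)} (hj : j ∉ A) : uncAt f W m A ≤ uncAt f W m (insert j A) := by
  cases m with
  | zero => exact j.elim0
  | succ m =>
    obtain ⟨B, rfl⟩ := exists_eq_liftSet j hj
    exact (uncAt_liftSet_le hf W j B).trans (le_uncAt_insert_liftSet hf W j B)

theorem uncAt_mono {f : ℝ → ℝ → ℝ} (hf : IsUncertainty f) (W : BinaryChannel 𝒴) {m : ℕ}
    {A B : Finset (Fin m)} (h : A ⊆ B) : uncAt f W m A ≤ uncAt f W m B := by
  induction B using Finset.strongInduction with
  | H B ih =>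
    rcases h.eq_or_ssubset with rfl | h'
    · exact le_rfl
    obtain ⟨j, hjB, hjA⟩ := Finset.exists_of_ssubset h'
    have h1 := ih (B.erase j) (Finset.erase_ssubset hjB) (Finset.subset_erase.2 ⟨h, hjA⟩)
    have h2 := uncAt_le_insert hf W (Finset.notMem_erase j B)
    rw [Finset.insert_erase hjB] at h2
    exact h1.trans h2

theorem uncAt_quadUnc_mem_Icc (W : BinaryChannel 𝒴) {m : ℕ} (A : Finset (Fin m)) :
    uncAt quadUnc W m A ∈ Set.Icc 0 1 :=
  ⟨condUnc_quadUnc_nonneg (jointLaw_nonneg W m) _ _,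
    condUnc_quadUnc_le_one (jointLaw_nonneg W m) (sum_jointLaw W m) _ _⟩

theorem uncAt_entropyUnc_mem_Icc (W : BinaryChannel 𝒴) {m : ℕ} (A : Finset (Fin m)) :
    uncAt entropyUnc W m A ∈ Set.Icc 0 1 :=
  condUnc_entropyUnc_mem_Icc (jointLaw_nonneg W m) (sum_jointLaw W m) _ _

theorem uncAt_bhattaUnc_nonneg (W : BinaryChannel 𝒴) {m : ℕ} (A : Finset (Fin m)) :
    0 ≤ uncAt bhattaUnc W m A :=
  condUnc_bhattaUnc_nonneg _ _ _

theorem log_two_mul_uncAt_le (W : BinaryChannel 𝒴) {m : ℕ} (A : Finset (Fin m)) :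
    Real.log 2 * uncAt entropyUnc W m A ≤ uncAt bhattaUnc W m A :=
  log_two_mul_condUnc_entropyUnc_le (jointLaw_nonneg W m) _ _

theorem one_sub_uncAt_entropyUnc_le (W : BinaryChannel 𝒴) {m : ℕ} (A : Finset (Fin m)) :
    1 - uncAt entropyUnc W m A ≤ (1 - uncAt quadUnc W m A) / Real.log 2 :=
  one_sub_condUnc_entropyUnc_le (jointLaw_nonneg W m) (sum_jointLaw W m) _ _

theorem uncAt_bhattaUnc_sq_le (W : BinaryChannel 𝒴) {m : ℕ} (A : Finset (Fin m)) :
    uncAt bhattaUnc W m A ^ 2 ≤ uncAt quadUnc W m A :=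
  condUnc_bhattaUnc_sq_le (jointLaw_nonneg W m) (sum_jointLaw W m) _ _

/-- One element of B \ A already gains the square by the exact "minus" recursion; monotonicity
covers the others. -/
theorem one_sub_uncAt_quadUnc_le_sq (W : BinaryChannel 𝒴) {m : ℕ} {A B : Finset (Fin m)}
    (h : A ⊂ B) : 1 - uncAt quadUnc W m B ≤ (1 - uncAt quadUnc W m A) ^ 2 := by
  obtain ⟨j, hjB, hjA⟩ := Finset.exists_of_ssubset h
  have hmono := uncAt_mono isUncertainty_quadUnc W (Finset.insert_subset hjB h.subset)
  cases m with
  | zero => exact j.elim0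
  | succ m =>
    obtain ⟨C, rfl⟩ := exists_eq_liftSet j hjA
    have h1 := one_sub_uncAt_quadUnc_insert_le W j C
    have h2 := uncAt_liftSet_le isUncertainty_quadUnc W j C
    have h3 := (uncAt_quadUnc_mem_Icc W C).2
    have h4 : (1 - uncAt quadUnc W m C) ^ 2 ≤
        (1 - uncAt quadUnc W (m + 1) (liftSet j C)) ^ 2 :=
      pow_le_pow_left₀ (by linarith) (by linarith) 2
    linarith

open Classical in
/-- The sets whose bits are not polarized. -/
def unpolarized (W : BinaryChannel 𝒴) (m : ℕ) (ε : ℝ) : Finset (Finset (Fin m)) :=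
  Finset.univ.filter fun A => ε < uncAt quadUnc W m A ∧ uncAt quadUnc W m A < 1 - ε

/-- If A ⊂ B and Q_A lies in (ε, 1 - ε), then Q_B ≥ Q_A + Q_A (1 - Q_A) ≥ Q_A + δ with δ = ε (1 -
ε). Hence the unpolarized sets with Q in one window of length δ form an antichain, and Sperner's
theorem bounds each window. -/
theorem card_unpolarized_le (W : BinaryChannel 𝒴) (m : ℕ) {ε : ℝ} (hε : 0 < ε) (hε1 : ε < 1) :
    (unpolarized W m ε).card ≤ m.choose (m / 2) * (⌊1 / (ε * (1 - ε))⌋₊ + 1) := by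
  classical
  set δ := ε * (1 - ε) with hδ
  have hδ0 : 0 < δ := mul_pos hε (by linarith)
  have key := Finset.card_le_mul_card_image_of_maps_to (s := unpolarized W m ε)
    (t := Finset.range (⌊1 / δ⌋₊ + 1)) (f := fun A => ⌊uncAt quadUnc W m A / δ⌋₊)
    (fun A _ => ?_) (m.choose (m / 2)) (fun k _ => ?_)
  · rwa [Finset.card_range] at key
  · rw [Finset.mem_range, Nat.lt_succ_iff]
    exact Nat.floor_mono (div_le_div_of_nonneg_right (uncAt_quadUnc_mem_Icc W A).2 hδ0.le)
  · have hanti : IsAntichain (· ⊆ ·)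
        ((unpolarized W m ε).filter fun A => ⌊uncAt quadUnc W m A / δ⌋₊ = k : Set (Finset (Fin m))) := by
      intro A hA B hB hne hsub
      simp only [Finset.coe_filter, Set.mem_ofPred_eq, unpolarized, Finset.mem_filter,
        Finset.mem_univ, true_and] at hA hB
      obtain ⟨⟨hA1, hA2⟩, hA3⟩ := hA
      obtain ⟨⟨hB1, hB2⟩, hB3⟩ := hB
      have h1 := one_sub_uncAt_quadUnc_le_sq W (hsub.ssubset_of_ne hne)
      have h2 : uncAt quadUnc W m A + δ ≤ uncAt quadUnc W m B := by
        rw [hδ]; nlinarith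
      have h3 : uncAt quadUnc W m B / δ < k + 1 := by
        rw [← hB3]; exact Nat.lt_floor_add_one _
      have h4 : (k : ℝ) ≤ uncAt quadUnc W m A / δ := by
        rw [← hA3]; exact Nat.floor_le (div_nonneg (uncAt_quadUnc_mem_Icc W A).1 hδ0.le)
      have h5 : (uncAt quadUnc W m A + δ) / δ ≤ uncAt quadUnc W m B / δ :=
        div_le_div_of_nonneg_right h2 hδ0.le
      rw [add_div, div_self hδ0.ne'] at h5
      linarith
    have := IsAntichain.sperner hanti
    rwa [Fintype.card_fin] at this

/-! ### Thresholds -/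

theorem firstSet_succ {m i : ℕ} (h : i ≤ m) :
    firstSet (m + 1) i = liftSet (Fin.last m) (firstSet m i) := by
  symm
  refine Finset.eq_of_subset_of_card_le (fun k hk => ?_) ?_
  · obtain ⟨l, hl, rfl⟩ := Finset.mem_map.1 hk
    simpa [firstSet] using hl
  · rw [card_liftSet, card_firstSet h, card_firstSet (h.trans m.le_succ)]

theorem uncAt_firstSet_succ_le {f : ℝ → ℝ → ℝ} (hf : IsUncertainty f) (W : BinaryChannel 𝒴)
    {m i : ℕ} (h : i ≤ m) :
    uncAt f W (m + 1) (firstSet (m + 1) i) ≤ uncAt f W m (firstSet m i) := by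
  rw [firstSet_succ h]
  exact uncAt_liftSet_le hf W _ _

theorem uncAt_firstSet_le_succ_succ {f : ℝ → ℝ → ℝ} (hf : IsUncertainty f) (W : BinaryChannel 𝒴)
    {m i : ℕ} (h : i ≤ m) :
    uncAt f W m (firstSet m i) ≤ uncAt f W (m + 1) (firstSet (m + 1) (i + 1)) := by
  have h1 := le_uncAt_insert_liftSet hf W (Fin.last m) (firstSet m i)
  have h2 := uncAt_le_firstSet hf W (insert (Fin.last m) (liftSet (Fin.last m) (firstSet m i)))
  rw [card_insert_liftSet, card_firstSet h] at h2
  exact h1.trans h2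

theorem uncAt_firstSet_mono {f : ℝ → ℝ → ℝ} (hf : IsUncertainty f) (W : BinaryChannel 𝒴)
    {m i j : ℕ} (h : i ≤ j) :
    uncAt f W m (firstSet m i) ≤ uncAt f W m (firstSet m j) := by
  refine uncAt_mono hf W fun k => ?_
  simp only [firstSet, Finset.mem_filter, Finset.mem_univ, true_and]
  omega

/-- Each new top coordinate lies outside the initial segment, hence acts as a "plus" step and
squares Z. -/
theorem uncAt_bhattaUnc_firstSet_add_le (W : BinaryChannel 𝒴) {m i : ℕ} (h : i ≤ m) (k : ℕ) :
    uncAt bhattaUnc W (m + k) (firstSet (m + k) i) ≤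
      uncAt bhattaUnc W m (firstSet m i) ^ 2 ^ k := by
  induction k with
  | zero => simp
  | succ k ih =>
    have h1 := uncAt_bhattaUnc_liftSet_le W (Fin.last (m + k)) (firstSet (m + k) i)
    rw [← firstSet_succ (by omega)] at h1
    refine h1.trans ?_
    rw [pow_succ 2 k, pow_mul]
    exact pow_le_pow_left₀ (uncAt_bhattaUnc_nonneg W _) ih 2

theorem bddAbove_lowMax (W : BinaryChannel 𝒴) (m : ℕ) : BddAbove (lowMax W m) :=
  ⟨m, fun _ hi => hi.1⟩

theorem bddAbove_lowMin (W : BinaryChannel 𝒴) (m : ℕ) : BddAbove (lowMin W m) :=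
  ⟨m, fun _ hi => hi.1⟩

theorem thetaMax_mem {W : BinaryChannel 𝒴} {m : ℕ} (h : (lowMax W m).Nonempty) :
    thetaMax W m ∈ lowMax W m := Nat.sSup_mem h (bddAbove_lowMax W m)

theorem thetaMax_le (W : BinaryChannel 𝒴) (m : ℕ) : thetaMax W m ≤ m := by
  rcases (lowMax W m).eq_empty_or_nonempty with h | h
  · simp [thetaMax, h]
  · exact (thetaMax_mem h).1

theorem entropy_le_half_of_card_le {W : BinaryChannel 𝒴} {m : ℕ} (h : (lowMax W m).Nonempty)
    {A : Finset (Fin m)} (hA : A.card ≤ thetaMax W m) : uncAt entropyUnc W m A ≤ 1 / 2 := by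
  have h1 := (thetaMax_mem h).2
  rw [entropyAt_eq_uncAt] at h1
  exact ((uncAt_le_firstSet isUncertainty_entropyUnc W A).trans
    (uncAt_firstSet_mono isUncertainty_entropyUnc W hA)).trans h1

theorem half_lt_entropy_of_lt_card {W : BinaryChannel 𝒴} {m : ℕ}
    {A : Finset (Fin m)} (hA : thetaMin W m < A.card) : 1 / 2 < uncAt entropyUnc W m A := by
  by_contra! hc
  refine hA.not_ge (le_csSup (bddAbove_lowMin W m) ⟨by simpa using A.card_le_univ, ?_⟩)
  rw [entropyAt_eq_uncAt]
  exact (lastSet_le_uncAt isUncertainty_entropyUnc W A).trans hc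

theorem thetaMax_le_succ {W : BinaryChannel 𝒴} {m : ℕ} (h : (lowMax W m).Nonempty) :
    thetaMax W m ≤ thetaMax W (m + 1) := by
  have h1 := thetaMax_mem h
  refine le_csSup (bddAbove_lowMax W _) ⟨h1.1.trans m.le_succ, ?_⟩
  have h2 := h1.2
  rw [entropyAt_eq_uncAt] at h2 ⊢
  exact (uncAt_firstSet_succ_le isUncertainty_entropyUnc W h1.1).trans h2

theorem thetaMax_succ_le {W : BinaryChannel 𝒴} {m : ℕ} (h : (lowMax W (m + 1)).Nonempty) :
    thetaMax W (m + 1) ≤ thetaMax W m + 1 := by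
  have h1 := thetaMax_mem h
  rcases hθ : thetaMax W (m + 1) with _ | i
  · omega
  rw [hθ] at h1
  have h3 : i ≤ m := by have := h1.1; omega
  refine Nat.succ_le_succ (le_csSup (bddAbove_lowMax W _) ⟨h3, ?_⟩)
  have h2 := h1.2
  rw [entropyAt_eq_uncAt] at h2 ⊢
  exact (uncAt_firstSet_le_succ_succ isUncertainty_entropyUnc W h3).trans h2

/-- The threshold moves by 0 or 1 per dimension, so taking it from k dimensions earlier costs at
most k levels of the code. -/
theorem thetaMax_add_bounds {W : BinaryChannel 𝒴} {m : ℕ}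
    (h : ∀ m', m ≤ m' → (lowMax W m').Nonempty) (k : ℕ) :
    thetaMax W m ≤ thetaMax W (m + k) ∧ thetaMax W (m + k) ≤ thetaMax W m + k := by
  induction k with
  | zero => simp
  | succ k ih =>
    have h1 := thetaMax_le_succ (h (m + k) (by omega))
    have h2 := thetaMax_succ_le (h (m + k + 1) (by omega))
    rw [← add_assoc]
    omega

/-- Numerically: 1 - Q ≥ (log 2) / 2 > 0.3, and then Z² ≤ Q ≤ 0.7 < 0.81. What matters below is that
Z stays away from 1. -/
theorem bhatta_le_of_entropy_le_half {W : BinaryChannel 𝒴} {m : ℕ} {A : Finset (Fin m)}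
    (h : uncAt entropyUnc W m A ≤ 1 / 2) :
    uncAt quadUnc W m A ≤ 7 / 10 ∧ uncAt bhattaUnc W m A ≤ 9 / 10 := by
  have h1 := one_sub_uncAt_entropyUnc_le W A
  have hl := Real.log_two_gt_d9
  rw [le_div_iff₀ (by linarith)] at h1
  have h2 : uncAt quadUnc W m A ≤ 7 / 10 := by nlinarith
  refine ⟨h2, ?_⟩
  have h3 := uncAt_bhattaUnc_sq_le W A
  nlinarith

theorem uncAt_bhattaUnc_le_pow {W : BinaryChannel 𝒴} {m k : ℕ} (h : (lowMax W m).Nonempty)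
    {A : Finset (Fin (m + k))} (hA : A.card ≤ thetaMax W m) :
    uncAt bhattaUnc W (m + k) A ≤ (9 / 10) ^ 2 ^ k := by
  have hm : A.card ≤ m := hA.trans (thetaMax_le W m)
  refine (uncAt_le_firstSet isUncertainty_bhattaUnc W A).trans ?_
  refine (uncAt_bhattaUnc_firstSet_add_le W hm k).trans ?_
  refine pow_le_pow_left₀ (uncAt_bhattaUnc_nonneg W _) ?_ _
  refine (bhatta_le_of_entropy_le_half (entropy_le_half_of_card_le h ?_)).2
  rwa [card_firstSet hm]

/-! ### The monomials form a basis -/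

/-- The two faces of the last coordinate recover the coefficients of the sets avoiding it and then,
by subtraction, of those containing it. -/
theorem encode_injective (m : ℕ) : Function.Injective (encode m) := by
  induction m with
  | zero =>
    intro u u' h
    have key : ∀ v : Finset (Fin 0) → ZMod 2, encode 0 v (fun _ => 0) = v ∅ := fun v => by
      have hu : (Finset.univ : Finset (Finset (Fin 0))) = {∅} := by decide
      rw [encode, hu]
      simp [monomialVec]
    funext A
    rw [Subsingleton.elim A ∅, ← key u, ← key u', h]
  | succ m ih =>
    intro u u' h
    have key : ∀ b : ZMod 2,
        (fun A => u (liftSet (Fin.last m) A) + b * u (insert (Fin.last m) (liftSet (Fin.last m) A))) =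
        fun A => u' (liftSet (Fin.last m) A) +
          b * u' (insert (Fin.last m) (liftSet (Fin.last m) A)) := fun b => by
      refine ih (funext fun z => ?_)
      rw [← encode_liftPoint, ← encode_liftPoint, h]
    have h0 : ∀ A, u (liftSet (Fin.last m) A) = u' (liftSet (Fin.last m) A) := fun A => by
      simpa using congrFun (key 0) A
    funext C
    by_cases hj : Fin.last m ∈ C
    · obtain ⟨A, rfl⟩ := exists_eq_insert_liftSet _ hj
      have h1 := congrFun (key 1) A
      simpa [h0 A] using h1
    · obtain ⟨A, rfl⟩ := exists_eq_liftSet _ hj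
      exact h0 A

/-- The bijection between coefficient vectors and words. -/
def encodeEquiv (m : ℕ) : (Finset (Fin m) → ZMod 2) ≃ Word m :=
  Equiv.ofBijective (encode m) <| by
    rw [Fintype.bijective_iff_injective_and_card]
    exact ⟨encode_injective m, by simp⟩

theorem encodeEquiv_apply (m : ℕ) (u : Finset (Fin m) → ZMod 2) :
    encodeEquiv m u = encode m u := rfl

/-! ### The chain rule -/

/-- An order embedding realising `setLT`. -/
def setKey {m : ℕ} (A : Finset (Fin m)) : ℕᵒᵈ ×ₗ Colex (Finset (Fin m)) :=
  toLex (OrderDual.toDual A.card, toColex A)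

theorem setKey_lt_iff {m : ℕ} {A B : Finset (Fin m)} : setKey A < setKey B ↔ setLT A B := by
  unfold setKey setLT
  rw [Prod.Lex.toLex_lt_toLex]
  simp

theorem setKey_injective {m : ℕ} : Function.Injective (setKey (m := m)) := by
  intro A B h
  exact toColex_inj.1 (Prod.mk.inj (toLex_inj.1 h)).2

/-- The expected log-likelihood of the outputs together with the bits indexed by `S`. -/
def logLik (W : BinaryChannel 𝒴) (m : ℕ) (S : Set (Finset (Fin m))) : ℝ :=
  ∑ ω, jointLaw W m ω *
    Real.logb 2 (probOf (jointLaw W m) fun ω' => observed S ω' = observed S ω)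

/-- `logLik` is minus the joint entropy of Y and the bits in `S`, so this is the chain rule for one
bit. -/
theorem uncAt_entropyUnc_eq_sub (W : BinaryChannel 𝒴) {m : ℕ} (A : Finset (Fin m)) :
    uncAt entropyUnc W m A =
      logLik W m {B | setLT B A} - logLik W m (insert A {B | setLT B A}) := by
  rw [uncAt, bitUnc, ← condEntropy_eq_condUnc, condEntropy, logLik, logLik,
    ← Finset.sum_sub_distrib, ← Finset.sum_neg_distrib]
  refine Finset.sum_congr rfl fun ω _ => ?_
  have hJ : probOf (jointLaw W m) (fun ω' => ω'.1 A = ω.1 A ∧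
      observed {B | setLT B A} ω' = observed {B | setLT B A} ω) =
      probOf (jointLaw W m) fun ω' => observed (insert A {B | setLT B A}) ω' =
        observed (insert A {B | setLT B A}) ω := by
    refine probOf_congr _ fun ω' => ?_
    rw [observed_eq_iff, observed_eq_iff]
    simp only [Set.mem_insert_iff, forall_eq_or_imp]
    tauto
  rw [hJ]
  rcases (jointLaw_nonneg W m ω).eq_or_lt with h | h
  · simp [← h]
  have hpos : ∀ S, 0 < probOf (jointLaw W m) fun ω' => observed S ω' = observed S ω := fun S =>
    h.trans_le (le_probOf (jointLaw_nonneg W m) rfl)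
  rw [Real.logb_div (hpos _).ne' (hpos _).ne']
  ring

/-- The terms telescope: the predecessors of the last element of an initial segment are exactly its
other elements. -/
theorem sum_uncAt_entropyUnc_of_lower (W : BinaryChannel 𝒴) {m : ℕ}
    (L : Finset (Finset (Fin m))) (hL : ∀ A ∈ L, ∀ B, setLT B A → B ∈ L) :
    ∑ A ∈ L, uncAt entropyUnc W m A = logLik W m ∅ - logLik W m L := by
  induction L using Finset.strongInduction with
  | H L ih =>
    rcases L.eq_empty_or_nonempty with rfl | hne
    · simp
    obtain ⟨A, hA, hmax⟩ := L.exists_max_image setKey hne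
    have hset : ((L.erase A : Finset _) : Set (Finset (Fin m))) = {B | setLT B A} := by
      ext B
      rw [Finset.mem_coe, Finset.mem_erase]
      change _ ↔ setLT B A
      rw [← setKey_lt_iff]
      constructor
      · rintro ⟨hBA, hB⟩
        exact lt_of_le_of_ne (hmax B hB) fun h => hBA (setKey_injective h)
      · intro h
        exact ⟨fun h' => lt_irrefl _ (h' ▸ h), hL A hA B (setKey_lt_iff.1 h)⟩
    have h1 := ih (L.erase A) (Finset.erase_ssubset hA) fun B hB C hC => by
      rw [Finset.mem_erase] at hB ⊢
      refine ⟨?_, hL B hB.2 C hC⟩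
      rintro rfl
      exact (setKey_lt_iff.2 hC).not_ge (hmax B hB.2)
    rw [← Finset.add_sum_erase L _ hA, h1, uncAt_entropyUnc_eq_sub, ← hset, ← Finset.coe_insert,
      Finset.insert_erase hA]
    ring

theorem sum_uncAt_entropyUnc_card_le (W : BinaryChannel 𝒴) (m r : ℕ) :
    ∑ A : Finset (Fin m) with A.card ≤ r, uncAt entropyUnc W m A =
      logLik W m {A | r < A.card} - logLik W m Set.univ := by
  have h1 := sum_uncAt_entropyUnc_of_lower W (m := m) Finset.univ fun A _ B _ => Finset.mem_univ B
  have h2 := sum_uncAt_entropyUnc_of_lower W (m := m) (Finset.univ.filter fun A => ¬ A.card ≤ r)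
    fun A hA B hB => by
      simp only [Finset.mem_filter, Finset.mem_univ, true_and, not_le] at hA ⊢
      rcases hB with hB | hB
      · exact hA.trans hB
      · rwa [hB.1]
  rw [← Finset.sum_filter_add_sum_filter_not _ fun A : Finset (Fin m) => A.card ≤ r, h2] at h1
  have h3 : ((Finset.univ.filter fun A : Finset (Fin m) => ¬ A.card ≤ r : Finset _) :
      Set (Finset (Fin m))) = {A | r < A.card} := by
    ext A; simp
  rw [h3, Finset.coe_univ] at h1
  linarith

/-! ### The total entropy -/

/-- The mutual information for uniform inputs. -/
def BinaryChannel.uniformInfo (W : BinaryChannel 𝒴) : ℝ := W.mutualInfo fun _ => 1 / 2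

/-- The output distribution for the input distribution `q`. -/
def BinaryChannel.outProb (W : BinaryChannel 𝒴) (q : ZMod 2 → ℝ) (y : 𝒴) : ℝ :=
  ∑ x, q x * W.prob x y

theorem sum_prod_mul_coord {ι α : Type*} [Fintype ι] [DecidableEq ι] [Fintype α]
    (w : α → ℝ) (hw : ∑ a, w a = 1) (g : α → ℝ) (i : ι) :
    ∑ t : ι → α, (∏ k, w (t k)) * g (t i) = ∑ a, w a * g a := by
  classical
  have h := Finset.prod_univ_sum (fun _ : ι => (Finset.univ : Finset α))
    fun k a => w a * if k = i then g a else 1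
  rw [Fintype.piFinset_univ] at h
  have h1 : ∀ t : ι → α, (∏ k, w (t k) * if k = i then g (t k) else 1) =
      (∏ k, w (t k)) * g (t i) := fun t => by
    rw [Finset.prod_mul_distrib]
    simp
  simp only [h1] at h
  rw [← h, Finset.prod_eq_single i (fun k _ hk => by simp [hk, hw]) (by simp)]
  simp

theorem logLik_univ (W : BinaryChannel 𝒴) (m : ℕ) :
    logLik W m Set.univ = ∑ ω, jointLaw W m ω * Real.logb 2 (jointLaw W m ω) := by
  classical
  unfold logLik
  refine Finset.sum_congr rfl fun ω _ => ?_
  have : probOf (jointLaw W m) (fun ω' => observed Set.univ ω' = observed Set.univ ω) =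
      probOf (jointLaw W m) (fun ω' => ω' = ω) := by
    refine probOf_congr _ fun ω' => ?_
    rw [observed_eq_iff]
    constructor
    · rintro ⟨h1, h2⟩
      exact Prod.ext (funext fun B => h2 B trivial) h1
    · rintro rfl; exact ⟨rfl, fun _ _ => rfl⟩
  rw [this, probOf_eq_sum_filter, Finset.filter_eq' Finset.univ ω]
  simp

theorem probOf_output_eq (W : BinaryChannel 𝒴) (m : ℕ) (y : Cube m → 𝒴) :
    probOf (jointLaw W m) (fun ω => ω.2 = y) = ∏ z, W.outProb (fun _ => 1 / 2) (y z) := by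
  classical
  have h := Finset.prod_univ_sum (fun _ : Cube m => (Finset.univ : Finset (ZMod 2)))
    fun z x => 1 / 2 * W.prob x (y z)
  rw [Fintype.piFinset_univ] at h
  unfold BinaryChannel.outProb
  rw [h, ← Equiv.sum_comp (encodeEquiv m)]
  unfold probOf
  rw [Fintype.sum_prod_type]
  refine Finset.sum_congr rfl fun u _ => ?_
  rw [Finset.sum_eq_single y (fun y' _ hy => by simp [hy]) (by simp), if_pos rfl,
    Finset.prod_mul_distrib, jointLaw, BinaryChannel.blockProb]
  simp [encodeEquiv_apply]

theorem sum_jointLaw_mul_coord (W : BinaryChannel 𝒴) {m : ℕ} (g : ZMod 2 → 𝒴 → ℝ) (z : Cube m) :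
    ∑ ω, jointLaw W m ω * g (encode m ω.1 z) (ω.2 z) =
      ∑ x, ∑ y, 1 / 2 * W.prob x y * g x y := by
  have hw : ∑ a : ZMod 2 × 𝒴, 1 / 2 * W.prob a.1 a.2 = 1 := by
    rw [Fintype.sum_prod_type]
    simp only [← Finset.mul_sum, W.sum_prob, sum_zmod_two]
    norm_num
  have h := sum_prod_mul_coord (fun a : ZMod 2 × 𝒴 => 1 / 2 * W.prob a.1 a.2) hw
    (fun a => g a.1 a.2) z
  rw [Fintype.sum_prod_type] at h
  rw [← h, ← Equiv.sum_comp (((encodeEquiv m).prodCongr (Equiv.refl _)).trans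
    (Equiv.arrowProdEquivProdArrow (Cube m) (fun _ => ZMod 2) (fun _ => 𝒴)).symm)]
  refine Finset.sum_congr rfl fun ω _ => ?_
  congr 1
  rw [Finset.prod_mul_distrib, jointLaw, BinaryChannel.blockProb]
  simp [encodeEquiv_apply, Equiv.arrowProdEquivProdArrow]

/-- The chain rule gives H(U | Y). As encoding is bijective, X is uniform and the pairs (X_z, Y_z)
are independent, so this is 2^m copies of the single-use H(X | Y) = 1 - I for uniform input. -/
theorem sum_uncAt_entropyUnc (W : BinaryChannel 𝒴) (m : ℕ) :
    ∑ A, uncAt entropyUnc W m A = 2 ^ m * (1 - W.uniformInfo) := by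
  have h0 := sum_uncAt_entropyUnc_of_lower W (m := m) Finset.univ fun A _ B _ => Finset.mem_univ B
  rw [h0, Finset.coe_univ, logLik_univ, logLik, ← Finset.sum_sub_distrib]
  set g : ZMod 2 → 𝒴 → ℝ := fun x y => Real.logb 2 (W.prob x y / W.outProb (fun _ => 1 / 2) y)
  have key : ∀ ω, jointLaw W m ω * Real.logb 2 (probOf (jointLaw W m) fun ω' =>
      observed ∅ ω' = observed ∅ ω) - jointLaw W m ω * Real.logb 2 (jointLaw W m ω) =
      ∑ z : Cube m, jointLaw W m ω * (1 - g (encode m ω.1 z) (ω.2 z)) := by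
    intro ω
    have hJ : probOf (jointLaw W m) (fun ω' => observed ∅ ω' = observed ∅ ω) =
        ∏ z, W.outProb (fun _ => 1 / 2) (ω.2 z) := by
      rw [← probOf_output_eq]
      refine probOf_congr _ fun ω' => ?_
      rw [observed_eq_iff]
      simp
    rw [hJ, ← mul_sub, ← Finset.mul_sum]
    rcases (jointLaw_nonneg W m ω).eq_or_lt with h | h
    · simp [← h]
    congr 1
    have hW : ∀ z, 0 < W.prob (encode m ω.1 z) (ω.2 z) := fun z => by
      refine lt_of_le_of_ne (W.prob_nonneg _ _) fun h1 => h.ne' ?_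
      rw [jointLaw, BinaryChannel.blockProb, Finset.prod_eq_zero (Finset.mem_univ z) h1.symm,
        mul_zero]
    have hP : ∀ z, 0 < W.outProb (fun _ => 1 / 2) (ω.2 z) := fun z => by
      refine lt_of_lt_of_le (mul_pos one_half_pos (hW z)) ?_
      exact Finset.single_le_sum (f := fun x => 1 / 2 * W.prob x (ω.2 z))
        (fun x _ => mul_nonneg one_half_pos.le (W.prob_nonneg _ _)) (Finset.mem_univ _)
    have hlaw : jointLaw W m ω = ∏ z, (1 / 2 * W.prob (encode m ω.1 z) (ω.2 z)) := by
      rw [Finset.prod_mul_distrib, jointLaw, BinaryChannel.blockProb]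
      simp
    rw [hlaw, Real.logb_prod _ _ fun z _ => (hP z).ne',
      Real.logb_prod _ _ fun z _ => (mul_pos one_half_pos (hW z)).ne', ← Finset.sum_sub_distrib]
    refine Finset.sum_congr rfl fun z _ => ?_
    change _ = 1 - Real.logb 2 (W.prob _ _ / W.outProb (fun _ => 1 / 2) _)
    rw [Real.logb_mul (by norm_num) (hW z).ne', Real.logb_div (hW z).ne' (hP z).ne',
      one_div, Real.logb_inv, Real.logb_self_eq_one one_lt_two]
    ring
  rw [Finset.sum_congr rfl fun ω _ => key ω, Finset.sum_comm]
  have hz : ∀ z : Cube m, ∑ ω, jointLaw W m ω * (1 - g (encode m ω.1 z) (ω.2 z)) =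
      1 - W.uniformInfo := by
    intro z
    simp only [mul_sub, mul_one, Finset.sum_sub_distrib, sum_jointLaw, sum_jointLaw_mul_coord W g]
    rfl
  simp only [hz, Finset.sum_const, Finset.card_univ, Fintype.card_fun, ZMod.card, Fintype.card_fin,
    nsmul_eq_mul, Nat.cast_pow, Nat.cast_ofNat]

theorem uniformInfo_mem_simplex : (fun _ => 1 / 2 : ZMod 2 → ℝ) ∈ stdSimplex ℝ (ZMod 2) :=
  ⟨fun _ => by norm_num, by rw [sum_zmod_two]; norm_num⟩

theorem outProb_nonneg (W : BinaryChannel 𝒴) {q : ZMod 2 → ℝ} (hq : ∀ x, 0 ≤ q x) (y : 𝒴) :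
    0 ≤ W.outProb q y := Finset.sum_nonneg fun x _ => mul_nonneg (hq x) (W.prob_nonneg x y)

theorem sum_outProb (W : BinaryChannel 𝒴) {q : ZMod 2 → ℝ} (hq : ∑ x, q x = 1) :
    ∑ y, W.outProb q y = 1 := by
  unfold BinaryChannel.outProb
  rw [Finset.sum_comm]
  simp only [← Finset.mul_sum, W.sum_prob, mul_one, hq]

/-- The difference of the two sides is minus the divergence of the output law under `q` from that
under uniform input, and divergence is nonnegative. -/
theorem mutualInfo_le_sum_divergence (W : BinaryChannel 𝒴) {q : ZMod 2 → ℝ}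
    (hq : q ∈ stdSimplex ℝ (ZMod 2)) : W.mutualInfo q ≤
      ∑ x, q x * ∑ y, W.prob x y * Real.logb 2 (W.prob x y / W.outProb (fun _ => 1 / 2) y) := by
  set u : ZMod 2 → ℝ := fun _ => 1 / 2
  have hl : 0 < Real.log 2 := Real.log_pos one_lt_two
  have hu0 : ∀ y, W.outProb u y = 0 → ∀ x, W.prob x y = 0 := by
    intro y hy x
    have := (Finset.sum_eq_zero_iff_of_nonneg fun x _ =>
      mul_nonneg (one_half_pos (α := ℝ)).le (W.prob_nonneg x y)).1 hy x (Finset.mem_univ x)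
    simpa [u] using this
  have key : W.mutualInfo q - ∑ x, q x * ∑ y, W.prob x y *
      Real.logb 2 (W.prob x y / W.outProb u y) =
      (∑ y, W.outProb q y * (Real.log (W.outProb u y) - Real.log (W.outProb q y))) /
        Real.log 2 := by
    have e1 : ∑ y, W.outProb q y * (Real.log (W.outProb u y) - Real.log (W.outProb q y)) =
        ∑ x, ∑ y, q x * W.prob x y * (Real.log (W.outProb u y) - Real.log (W.outProb q y)) := by
      rw [Finset.sum_comm]
      exact Finset.sum_congr rfl fun y _ => by rw [← Finset.sum_mul]; rfl
    rw [e1, Finset.sum_div, BinaryChannel.mutualInfo, ← Finset.sum_sub_distrib]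
    refine Finset.sum_congr rfl fun x _ => ?_
    rw [Finset.mul_sum, Finset.sum_div, ← Finset.sum_sub_distrib]
    refine Finset.sum_congr rfl fun y _ => ?_
    change q x * W.prob x y * Real.logb 2 (W.prob x y / W.outProb q y) - _ = _
    rcases (mul_nonneg (hq.1 x) (W.prob_nonneg x y)).eq_or_lt with h | h
    · rw [← mul_assoc, ← h]; simp
    have hW : W.prob x y ≠ 0 := fun h0 => by simp [h0] at h
    have hQ : W.outProb q y ≠ 0 := by
      refine (h.trans_le ?_).ne'
      exact Finset.single_le_sum (f := fun x => q x * W.prob x y)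
        (fun x _ => mul_nonneg (hq.1 x) (W.prob_nonneg _ _)) (Finset.mem_univ _)
    have hU : W.outProb u y ≠ 0 := fun h0 => hW (hu0 y h0 x)
    rw [Real.logb_div hW hQ, Real.logb_div hW hU]
    unfold Real.logb
    ring
  have hle : ∑ y, W.outProb q y * (Real.log (W.outProb u y) - Real.log (W.outProb q y)) ≤ 0 := by
    calc _ ≤ ∑ y, (W.outProb u y - W.outProb q y) := by
          refine Finset.sum_le_sum fun y _ => mul_log_sub_log_le (outProb_nonneg W hq.1 y)
            (outProb_nonneg W uniformInfo_mem_simplex.1 y) fun h => ?_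
          exact Finset.sum_eq_zero fun x _ => by rw [hu0 y h x, mul_zero]
      _ = 0 := by
          rw [Finset.sum_sub_distrib, sum_outProb W hq.2, sum_outProb W uniformInfo_mem_simplex.2,
            sub_self]
  have := div_nonpos_of_nonpos_of_nonneg hle hl.le
  rw [← key] at this
  linarith

/-- The capacity of a symmetric channel is attained by the uniform input distribution. -/
theorem capacity_eq_uniformInfo {W : BinaryChannel 𝒴} (hW : W.IsSymmetric) :
    W.capacity = W.uniformInfo := by
  obtain ⟨π, hπ, hsymm⟩ := hW
  refine IsGreatest.csSup_eq ⟨⟨_, uniformInfo_mem_simplex, rfl⟩, ?_⟩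
  rintro _ ⟨q, hq, rfl⟩
  refine (mutualInfo_le_sum_divergence W hq).trans_eq ?_
  set D : ZMod 2 → ℝ := fun x =>
    ∑ y, W.prob x y * Real.logb 2 (W.prob x y / W.outProb (fun _ => 1 / 2) y)
  have hout : ∀ y, W.outProb (fun _ => 1 / 2) (π y) = W.outProb (fun _ => 1 / 2) y := by
    intro y
    unfold BinaryChannel.outProb
    rw [sum_zmod_two, sum_zmod_two, hsymm, hsymm, hπ y]
    ring
  -- The symmetry exchanges the two rows of the channel and preserves the uniform output law, so the
  -- upper bound does not depend on the input distribution.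
  have hD : D 1 = D 0 := by
    change (∑ y : 𝒴, _ : ℝ) = ∑ y : 𝒴, _
    rw [← Equiv.sum_comp π fun y =>
      W.prob 0 y * Real.logb 2 (W.prob 0 y / W.outProb (fun _ => 1 / 2) y)]
    exact Finset.sum_congr rfl fun y _ => by rw [hout, hsymm]
  have h1 : W.uniformInfo = ∑ x, 1 / 2 * D x := by
    unfold BinaryChannel.uniformInfo BinaryChannel.mutualInfo
    refine Finset.sum_congr rfl fun x _ => ?_
    rw [Finset.mul_sum]
    exact Finset.sum_congr rfl fun y _ => mul_assoc _ _ _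
  have h2 := hq.2
  rw [sum_zmod_two] at h2
  rw [h1]
  change ∑ x, q x * D x = _
  rw [sum_zmod_two, sum_zmod_two, hD, ← add_mul, h2]
  ring

/-! ### Maximum a posteriori decoding -/

/-- Choosing a likeliest sample in each fibre errs there with conditional probability 1 - max ≤ -log
max, which is at most the conditional entropy in nats. -/
theorem exists_decoder_error_le {Ω T : Type*} [Fintype Ω] [Fintype T] [Nonempty Ω] {p : Ω → ℝ}
    (hp : ∀ ω, 0 ≤ p ω) (V : Ω → T) :
    ∃ D : T → Ω, probOf p (fun ω => D (V ω) ≠ ω) ≤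
      ∑ ω, p ω * (Real.log (probOf p fun ω' => V ω' = V ω) - Real.log (p ω)) := by
  classical
  have hD : ∀ t : T, ∃ ω₀ : Ω, ∀ ω, V ω = t → V ω₀ = t ∧ p ω ≤ p ω₀ := by
    intro t
    rcases (Finset.univ.filter fun ω => V ω = t).eq_empty_or_nonempty with h | h
    · refine ⟨Classical.arbitrary Ω, fun ω hω => ?_⟩
      exact absurd (Finset.mem_filter.2 ⟨Finset.mem_univ ω, hω⟩) (h ▸ Finset.notMem_empty ω)
    · obtain ⟨ω₀, h1, h2⟩ := Finset.exists_max_image _ p h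
      exact ⟨ω₀, fun ω hω =>
        ⟨(Finset.mem_filter.1 h1).2, h2 ω (Finset.mem_filter.2 ⟨Finset.mem_univ ω, hω⟩)⟩⟩
  choose D hD using hD
  refine ⟨D, ?_⟩
  rw [← sum_probOf_fiber p _ V, ← Finset.sum_fiberwise Finset.univ V]
  refine Finset.sum_le_sum fun t _ => ?_
  set P := probOf p fun ω => V ω = t with hP
  -- Both sides carry a factor `P`, the mass of the fibre, which is cancelled after summing over it.
  have hterm : ∀ ω, V ω = t → p ω * (P - p (D t)) ≤
      P * (p ω * (Real.log (probOf p fun ω' => V ω' = V ω) - Real.log (p ω))) := by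
    intro ω hω
    rw [hω, ← hP]
    rcases (hp ω).eq_or_lt with h | h
    · simp [← h]
    have h1 : p ω ≤ p (D t) := (hD t ω hω).2
    have h2 : p (D t) ≤ P := le_probOf hp (hD t ω hω).1
    have h3 := mul_log_sub_log_le (a := P) (b := p (D t)) (by linarith) (by linarith)
      fun h0 => by linarith
    have h4 : Real.log (p ω) ≤ Real.log (p (D t)) := Real.log_le_log h h1
    have h5 : P * Real.log (p ω) ≤ P * Real.log (p (D t)) :=
      mul_le_mul_of_nonneg_left h4 (by linarith)
    nlinarith
  by_cases hne : ∃ ω, V ω = t ∧ 0 < p ω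
  swap
  · push Not at hne
    have hz : ∀ ω, V ω = t → p ω = 0 := fun ω hω => le_antisymm (hne ω hω) (hp ω)
    rw [probOf_eq_sum_filter, Finset.sum_eq_zero, Finset.sum_eq_zero]
    · intro ω hω
      rw [hz ω (Finset.mem_filter.1 hω).2, zero_mul]
    · intro ω hω
      exact hz ω (Finset.mem_filter.1 hω).2.2
  obtain ⟨ω₁, hω₁, hpos⟩ := hne
  have hPpos : 0 < P := hpos.trans_le (le_probOf hp hω₁)
  have hsplit : probOf p (fun ω => D (V ω) ≠ ω ∧ V ω = t) = P - p (D t) := by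
    have hf : Finset.univ.filter (fun ω => D (V ω) ≠ ω ∧ V ω = t) =
        (Finset.univ.filter fun ω => V ω = t).erase (D t) := by
      ext ω
      simp only [Finset.mem_filter, Finset.mem_univ, true_and, Finset.mem_erase]
      refine and_congr_left fun h => ?_
      rw [h, ne_comm]
    have hm : D t ∈ Finset.univ.filter fun ω => V ω = t :=
      Finset.mem_filter.2 ⟨Finset.mem_univ _, (hD t ω₁ hω₁).1⟩
    rw [probOf_eq_sum_filter, hf, hP, probOf_eq_sum_filter, ← Finset.add_sum_erase _ p hm]
    ring
  have hsum := Finset.sum_le_sum (s := Finset.univ.filter fun ω => V ω = t) fun ω hω =>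
    hterm ω (Finset.mem_filter.1 hω).2
  rw [← Finset.sum_mul, ← Finset.mul_sum, ← probOf_eq_sum_filter, ← hP] at hsum
  rw [hsplit]
  exact le_of_mul_le_mul_left hsum hPpos

/-! ### Reed-Muller codes and their error probability -/

theorem encode_add (m : ℕ) (u v : Finset (Fin m) → ZMod 2) :
    encode m (u + v) = encode m u + encode m v := by
  unfold encode
  rw [← Finset.sum_add_distrib]
  exact Finset.sum_congr rfl fun A _ => by rw [Pi.add_apply, add_smul]

theorem rmCode_eq_image (m r : ℕ) :
    rmCode m r = (Fintype.piFinset fun A : Finset (Fin m) =>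
      if A.card ≤ r then Finset.univ else ({0} : Finset (ZMod 2))).image (encode m) := by
  ext x
  simp only [rmCode, Finset.mem_image, Finset.mem_univ, true_and, Fintype.mem_piFinset]
  constructor
  · rintro ⟨u, rfl⟩
    refine ⟨fun A => if A.card ≤ r then u A else 0, fun A => ?_, ?_⟩
    · by_cases h : A.card ≤ r <;> simp [h]
    · rw [encode, Finset.sum_filter]
      refine Finset.sum_congr rfl fun A _ => ?_
      split_ifs <;> simp
  · rintro ⟨u, hu, rfl⟩
    refine ⟨u, ?_⟩
    rw [encode, Finset.sum_filter]
    refine Finset.sum_congr rfl fun A _ => ?_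
    split_ifs with h
    · rfl
    · have := hu A
      rw [if_neg h, Finset.mem_singleton] at this
      rw [this, zero_smul]

theorem mem_rmCode_iff {m r : ℕ} {x : Word m} :
    x ∈ rmCode m r ↔ ∃ u, encode m u = x ∧ ∀ A, r < A.card → u A = 0 := by
  rw [rmCode_eq_image, Finset.mem_image]
  refine exists_congr fun u => ?_
  rw [and_comm, Fintype.mem_piFinset]
  refine and_congr_right fun _ => forall_congr' fun A => ?_
  split_ifs with h
  · simp [h]
  · simp [not_le.1 h]

theorem card_rmCode (m r : ℕ) :
    (rmCode m r).card = 2 ^ (Finset.univ.filter fun A : Finset (Fin m) => A.card ≤ r).card := by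
  rw [rmCode_eq_image, Finset.card_image_of_injective _ (encode_injective m),
    Fintype.card_piFinset, ← Finset.prod_const, Finset.prod_filter]
  refine Finset.prod_congr rfl fun A _ => ?_
  split_ifs <;> simp

theorem rate_rmCode (m r : ℕ) :
    rate (rmCode m r) =
      (Finset.univ.filter fun A : Finset (Fin m) => A.card ≤ r).card / 2 ^ m := by
  rw [rate, card_rmCode, Nat.cast_pow, Nat.cast_ofNat, Real.logb_pow,
    Real.logb_self_eq_one one_lt_two, mul_one]

/-- Averaged over all shifts, the sum over a coset is |C| times the mean of `g`, so some shift does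
no worse. -/
theorem exists_shift_sum_le {G : Type*} [AddCommGroup G] [Fintype G] (C : Finset G) (g : G → ℝ) :
    ∃ s, ∑ c ∈ C, g (c + s) ≤ C.card * ((Fintype.card G : ℝ)⁻¹ * ∑ x, g x) := by
  have h1 : ∑ s, ∑ c ∈ C, g (c + s) = C.card * ∑ x, g x := by
    have h2 : ∀ c, ∑ s, g (c + s) = ∑ x, g x := fun c => Equiv.sum_comp (Equiv.addLeft c) g
    rw [Finset.sum_comm, Finset.sum_congr rfl fun c _ => h2 c, Finset.sum_const, nsmul_eq_mul]
  have hG : (Fintype.card G : ℝ) ≠ 0 := by simp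
  obtain ⟨s, -, hs⟩ := Finset.exists_le_of_sum_le (s := (Finset.univ : Finset G))
    (f := fun s => ∑ c ∈ C, g (c + s))
    (g := fun _ => C.card * ((Fintype.card G : ℝ)⁻¹ * ∑ x, g x)) Finset.univ_nonempty (by
      rw [h1, Finset.sum_const, Finset.card_univ, nsmul_eq_mul]
      field_simp
      exact le_rfl)
  exact ⟨s, hs⟩

/-- Flipping the inputs at the support of `s` amounts to applying `π` to the outputs there. -/
def flipOutput {m : ℕ} (π : Equiv.Perm 𝒴) (s : Word m) : (Cube m → 𝒴) ≃ (Cube m → 𝒴) :=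
  Equiv.piCongrRight fun z => if s z = 0 then Equiv.refl 𝒴 else π

theorem blockProb_add_flipOutput {W : BinaryChannel 𝒴} {π : Equiv.Perm 𝒴}
    (hπ : Function.Involutive π) (hW : ∀ y, W.prob 1 y = W.prob 0 (π y)) {m : ℕ} (x s : Word m)
    (y : Cube m → 𝒴) : W.blockProb (x + s) (flipOutput π s y) = W.blockProb x y := by
  refine Finset.prod_congr rfl fun z => fun _ => ?_
  have h2 : ∀ a : ZMod 2, a = 0 ∨ a = 1 := by decide
  have h3 : (1 : ZMod 2) + 1 = 0 := by decide
  simp only [flipOutput, Pi.add_apply, Equiv.piCongrRight_apply, Pi.map_apply]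
  rcases h2 (s z) with hs | hs
  · simp [hs]
  · rcases h2 (x z) with hx | hx
    · simp [hs, hx, hW, hπ (y z)]
    · simp [hs, hx, hW, h3]

theorem nonempty_output (W : BinaryChannel 𝒴) : Nonempty 𝒴 := by
  by_contra h
  rw [not_nonempty_iff] at h
  simpa using W.sum_prob 0

theorem exists_decoder_blockError_le {W : BinaryChannel 𝒴} (hW : W.IsSymmetric) (m r : ℕ) :
    ∃ d : (Cube m → 𝒴) → Word m, blockError W (rmCode m r) d ≤
      Real.log 2 * ∑ A : Finset (Fin m) with A.card ≤ r, uncAt entropyUnc W m A := by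
  classical
  obtain ⟨π, hπ, hsymm⟩ := hW
  have := nonempty_output W
  set F : Set (Finset (Fin m)) := {A | r < A.card} with hF
  obtain ⟨D, hD⟩ := exists_decoder_error_le (jointLaw_nonneg W m) (observed F)
  have hl : Real.log 2 ≠ 0 := (Real.log_pos one_lt_two).ne'
  have hbound : ∑ ω, jointLaw W m ω * (Real.log (probOf (jointLaw W m) fun ω' =>
      observed F ω' = observed F ω) - Real.log (jointLaw W m ω)) =
      Real.log 2 * ∑ A : Finset (Fin m) with A.card ≤ r, uncAt entropyUnc W m A := by
    rw [sum_uncAt_entropyUnc_card_le, logLik_univ, logLik, ← Finset.sum_sub_distrib,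
      Finset.mul_sum]
    refine Finset.sum_congr rfl fun ω _ => ?_
    unfold Real.logb
    field_simp
    rfl
  rw [hbound] at hD
  set g : Word m → ℝ := fun x => ∑ y, if D (observed F ((encodeEquiv m).symm x, y)) =
    ((encodeEquiv m).symm x, y) then 0 else W.blockProb x y with hg
  have herr : probOf (jointLaw W m) (fun ω => D (observed F ω) ≠ ω) =
      (Fintype.card (Word m) : ℝ)⁻¹ * ∑ x, g x := by
    have hcard : (Fintype.card (Word m) : ℝ)⁻¹ = (1 / 2) ^ 2 ^ m := by simp
    rw [hcard, ← Equiv.sum_comp (encodeEquiv m), probOf, Fintype.sum_prod_type, Finset.mul_sum]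
    refine Finset.sum_congr rfl fun u _ => ?_
    rw [hg, Finset.mul_sum]
    refine Finset.sum_congr rfl fun y _ => ?_
    simp only [Equiv.symm_apply_apply, ne_eq, mul_ite, mul_zero]
    split_ifs with h
    · rfl
    · rfl
  obtain ⟨s, hs⟩ := exists_shift_sum_le (rmCode m r) g
  rw [← herr] at hs
  set v := (encodeEquiv m).symm s with hv
  have hvs : encode m v = s := (encodeEquiv m).apply_symm_apply s
  -- Simulate transmission in the good coset: flip the outputs on the support of `s`, decode with
  -- the frozen bits of `v`, and undo the shift.
  refine ⟨fun y => encode m (D (observed F (v, flipOutput π s y))).1 - s, ?_⟩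
  have hCpos : 0 < ((rmCode m r).card : ℝ) := by rw [card_rmCode]; positivity
  refine le_trans ?_ hD
  rw [blockError, inv_mul_le_iff₀ hCpos]
  refine le_trans (Finset.sum_le_sum fun x hx => ?_) hs
  obtain ⟨u, rfl, hu⟩ := mem_rmCode_iff.1 hx
  have huv : (encodeEquiv m).symm (encode m u + s) = u + v := by
    rw [Equiv.symm_apply_eq, encodeEquiv_apply, encode_add, hvs]
  -- Codewords have zero frozen bits, so the frozen bits of the shifted word are those of `v`, which
  -- the decoder knows.
  have hobs : ∀ y : Cube m → 𝒴, observed F (u + v, y) = observed F (v, y) := fun y => by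
    rw [observed_eq_iff]
    refine ⟨rfl, fun B hB => ?_⟩
    change u B + v B = v B
    rw [hu B hB, zero_add]
  simp only [hg, huv, hobs]
  rw [← Equiv.sum_comp (flipOutput π s) fun y => if D (observed F (v, y)) = (u + v, y) then 0
    else W.blockProb (encode m u + s) y]
  refine Finset.sum_le_sum fun y _ => ?_
  rw [blockProb_add_flipOutput hπ hsymm]
  split_ifs with h1 h2 h2
  · exact le_rfl
  · exact W.blockProb_nonneg _ _
  · refine absurd ?_ h1
    rw [h2, encode_add, hvs, add_sub_cancel_right]
  · exact le_rfl

/-! ### The middle binomial coefficient -/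

/-- The induction closes because (2n + 1)(2n + 3) ≤ 4 (n + 1)². -/
theorem centralBinom_sq_mul_le (n : ℕ) : n.centralBinom ^ 2 * (2 * n + 1) ≤ 16 ^ n := by
  induction n with
  | zero => simp
  | succ n ih =>
    have h := Nat.succ_mul_centralBinom_succ n
    refine Nat.le_of_mul_le_mul_left (c := (n + 1) ^ 2) ?_ (by positivity)
    calc (n + 1) ^ 2 * ((n + 1).centralBinom ^ 2 * (2 * (n + 1) + 1))
        = ((n + 1) * (n + 1).centralBinom) ^ 2 * (2 * n + 3) := by ring
      _ = n.centralBinom ^ 2 * (2 * n + 1) * (4 * (2 * n + 1) * (2 * n + 3)) := by rw [h]; ring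
      _ ≤ 16 ^ n * (16 * (n + 1) ^ 2) := Nat.mul_le_mul ih (by nlinarith)
      _ = (n + 1) ^ 2 * 16 ^ (n + 1) := by ring

theorem choose_half_sq_mul_le (m : ℕ) : m.choose (m / 2) ^ 2 * m ≤ 4 ^ m := by
  rcases Nat.even_or_odd' m with ⟨n, rfl | rfl⟩
  · have h := centralBinom_sq_mul_le n
    rw [Nat.centralBinom_eq_two_mul_choose] at h
    rw [Nat.mul_div_cancel_left n two_pos, pow_mul]
    exact (Nat.mul_le_mul_left _ (Nat.le_succ _)).trans h
  · have h := centralBinom_sq_mul_le (n + 1)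
    have h1 : (n + 1).centralBinom = 2 * (2 * n + 1).choose n := by
      rw [Nat.centralBinom_eq_two_mul_choose, show 2 * (n + 1) = 2 * n + 1 + 1 by ring,
        Nat.choose_succ_succ, Nat.choose_symm_half]
      ring
    have h2 : (2 * n + 1) / 2 = n := by omega
    rw [h1] at h
    rw [h2, pow_succ 4, pow_mul]
    norm_num only at h ⊢
    have h3 : 4 * ((2 * n + 1).choose n ^ 2 * (2 * n + 1)) ≤ 16 ^ (n + 1) := by
      refine le_trans ?_ h
      nlinarith [Nat.zero_le ((2 * n + 1).choose n ^ 2)]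
    rw [pow_succ 16 n] at h3
    omega

theorem choose_half_div_le {m : ℕ} (hm : 0 < m) :
    (m.choose (m / 2) : ℝ) / 2 ^ m ≤ 1 / Real.sqrt m := by
  have hs : 0 < Real.sqrt m := Real.sqrt_pos.2 (by exact_mod_cast hm)
  rw [div_le_div_iff₀ (by positivity) hs, one_mul]
  refine abs_le_of_sq_le_sq' ?_ (by positivity) |>.2
  rw [mul_pow, Real.sq_sqrt (Nat.cast_nonneg m), ← pow_mul, mul_comm m 2, pow_mul]
  norm_num only
  exact_mod_cast choose_half_sq_mul_le m

theorem card_levels_le (m a b : ℕ) :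
    (Finset.univ.filter fun A : Finset (Fin m) => a < A.card ∧ A.card ≤ b).card ≤
      m.choose (m / 2) * (b - a) := by
  have key := Finset.card_le_mul_card_image_of_maps_to
    (s := Finset.univ.filter fun A : Finset (Fin m) => a < A.card ∧ A.card ≤ b)
    (t := Finset.Ioc a b) (f := Finset.card) (fun A hA => by simpa using hA) (m.choose (m / 2))
    fun k _ => by
      refine le_trans (Finset.card_le_card (t := Finset.powersetCard k Finset.univ) fun A hA => ?_)
        ?_
      · simpa using (Finset.mem_filter.1 hA).2
      · rw [Finset.card_powersetCard, Finset.card_univ, Fintype.card_fin]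
        exact Nat.choose_le_middle k m
  rwa [Nat.card_Ioc] at key

/-! ### The rate -/

/-- The number of coefficients of the Reed-Muller code of order `r`. -/
def rmDim (m r : ℕ) : ℕ := (Finset.univ.filter fun A : Finset (Fin m) => A.card ≤ r).card

theorem rmDim_add (m : ℕ) {r s : ℕ} (h : r ≤ s) : rmDim m s = rmDim m r +
    (Finset.univ.filter fun A : Finset (Fin m) => r < A.card ∧ A.card ≤ s).card := by
  unfold rmDim
  rw [← Finset.card_union_of_disjoint]
  · congr 1
    ext A
    simp only [Finset.mem_filter, Finset.mem_univ, true_and, Finset.mem_union]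
    omega
  · rw [Finset.disjoint_filter]
    intro A _ h1 h2
    omega

/-- The threshold 1/2 decides which polarization alternative holds: H ≤ 1/2 gives Q ≤ 7/10, and H >
1/2 gives Q ≥ Z² > 1/16 ≥ η². The level η² is chosen because passing from Q to Z costs a square
root. -/
theorem abs_entropy_sub_indicator_le {W : BinaryChannel 𝒴} {m : ℕ} (h : (lowMax W m).Nonempty)
    {η : ℝ} (hη : 0 < η) (hη1 : η ≤ 1 / 4) {A : Finset (Fin m)}
    (hA : A ∉ unpolarized W m (η ^ 2))
    (hA' : ¬ (thetaMax W m < A.card ∧ A.card ≤ thetaMin W m)) :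
    |uncAt entropyUnc W m A - if A.card ≤ thetaMax W m then 0 else 1| ≤ 2 * η := by
  have hpol : uncAt quadUnc W m A ≤ η ^ 2 ∨ 1 - η ^ 2 ≤ uncAt quadUnc W m A := by
    by_contra! hc
    exact hA (Finset.mem_filter.2 ⟨Finset.mem_univ _, hc⟩)
  have hl := Real.log_two_gt_d9
  have hHZ := log_two_mul_uncAt_le W A
  have hZQ := uncAt_bhattaUnc_sq_le W A
  have hZ0 := uncAt_bhattaUnc_nonneg W A
  obtain ⟨hH0, hH1⟩ := uncAt_entropyUnc_mem_Icc W A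
  have hη2 : η ^ 2 ≤ 1 / 16 := by nlinarith
  split_ifs with hc
  · have hhalf := entropy_le_half_of_card_le h hc
    have hQ := (bhatta_le_of_entropy_le_half hhalf).1
    have hQ' : uncAt quadUnc W m A ≤ η ^ 2 := by
      rcases hpol with h1 | h1
      · exact h1
      · linarith
    have hZ : uncAt bhattaUnc W m A ≤ η := by nlinarith
    rw [sub_zero, abs_of_nonneg hH0]
    nlinarith
  · have hlt : thetaMin W m < A.card := by omega
    have hhalf := half_lt_entropy_of_lt_card hlt
    have hZ : 1 / 4 < uncAt bhattaUnc W m A := by nlinarith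
    have hQ' : 1 - η ^ 2 ≤ uncAt quadUnc W m A := by
      rcases hpol with h1 | h1
      · nlinarith
      · exact h1
    have h1 := one_sub_uncAt_entropyUnc_le W A
    rw [le_div_iff₀ (by linarith)] at h1
    rw [abs_of_nonpos (by linarith)]
    nlinarith

/-- Compare the total entropy with the number of sets above level θ_max: unpolarized sets and sets
on the levels between the thresholds cost at most 1 each, all others at most 2η. -/
theorem abs_rmDim_thetaMax_sub_le {W : BinaryChannel 𝒴} {m : ℕ} (h : (lowMax W m).Nonempty)
    {η : ℝ} (hη : 0 < η) (hη1 : η ≤ 1 / 4) :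
    |(rmDim m (thetaMax W m) : ℝ) - 2 ^ m * W.uniformInfo| ≤
      m.choose (m / 2) * ((⌊1 / (η ^ 2 * (1 - η ^ 2))⌋₊ + 1 : ℕ) +
        |(thetaMin W m : ℝ) - thetaMax W m|) + 2 ^ m * (2 * η) := by
  classical
  set U := unpolarized W m (η ^ 2)
  set L := Finset.univ.filter fun A : Finset (Fin m) =>
    thetaMax W m < A.card ∧ A.card ≤ thetaMin W m with hL
  have e1 : ∑ A : Finset (Fin m), (if A.card ≤ thetaMax W m then (0 : ℝ) else 1) =
      2 ^ m - rmDim m (thetaMax W m) := by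
    have h2 : ∀ A : Finset (Fin m), (if A.card ≤ thetaMax W m then (0 : ℝ) else 1) =
        1 - if A.card ≤ thetaMax W m then 1 else 0 := fun A => by split_ifs <;> norm_num
    simp only [h2, Finset.sum_sub_distrib, Finset.sum_boole, Finset.sum_const, nsmul_eq_mul,
      mul_one, Finset.card_univ, Fintype.card_finset, Fintype.card_fin, Nat.cast_pow,
      Nat.cast_ofNat]
    rfl
  have e2 : (rmDim m (thetaMax W m) : ℝ) - 2 ^ m * W.uniformInfo =
      ∑ A : Finset (Fin m), (uncAt entropyUnc W m A - if A.card ≤ thetaMax W m then 0 else 1) := by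
    rw [Finset.sum_sub_distrib, sum_uncAt_entropyUnc, e1]
    ring
  have hterm : ∀ A : Finset (Fin m),
      |uncAt entropyUnc W m A - if A.card ≤ thetaMax W m then 0 else 1| ≤
        (if A ∈ U then 1 else 0) + (if A ∈ L then 1 else 0) + 2 * η := by
    intro A
    obtain ⟨hH0, hH1⟩ := uncAt_entropyUnc_mem_Icc W A
    have htriv : |uncAt entropyUnc W m A - if A.card ≤ thetaMax W m then 0 else 1| ≤ 1 := by
      rw [abs_le]
      split_ifs <;> constructor <;> linarith
    by_cases hU : A ∈ U
    · rw [if_pos hU]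
      have : (0 : ℝ) ≤ if A ∈ L then 1 else 0 := by split_ifs <;> norm_num
      linarith
    by_cases hAL : A ∈ L
    · rw [if_neg hU, if_pos hAL]
      linarith
    rw [if_neg hU, if_neg hAL]
    simpa using abs_entropy_sub_indicator_le h hη hη1 hU fun hc =>
      hAL (Finset.mem_filter.2 ⟨Finset.mem_univ _, hc⟩)
  have hU : (U.card : ℝ) ≤ m.choose (m / 2) * (⌊1 / (η ^ 2 * (1 - η ^ 2))⌋₊ + 1 : ℕ) := by
    have hη2 : η ^ 2 < 1 := pow_lt_one₀ hη.le (by linarith) two_ne_zero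
    exact_mod_cast card_unpolarized_le W m (pow_pos hη 2) hη2
  have hLc : (L.card : ℝ) ≤ m.choose (m / 2) * |(thetaMin W m : ℝ) - thetaMax W m| := by
    have h1 : (L.card : ℝ) ≤ m.choose (m / 2) * (thetaMin W m - thetaMax W m : ℕ) := by
      exact_mod_cast card_levels_le m (thetaMax W m) (thetaMin W m)
    refine h1.trans (mul_le_mul_of_nonneg_left ?_ (Nat.cast_nonneg _))
    rcases le_total (thetaMax W m) (thetaMin W m) with h2 | h2
    · rw [Nat.cast_sub h2]; exact le_abs_self _
    · rw [Nat.sub_eq_zero_of_le h2, Nat.cast_zero]; exact abs_nonneg _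
  rw [e2]
  calc _ ≤ ∑ A : Finset (Fin m), ((if A ∈ U then 1 else 0) + (if A ∈ L then 1 else 0) + 2 * η) :=
        (Finset.abs_sum_le_sum_abs _ _).trans (Finset.sum_le_sum fun A _ => hterm A)
    _ = U.card + L.card + 2 ^ m * (2 * η) := by
        simp [Finset.sum_add_distrib]
    _ ≤ _ := by rw [mul_add]; linarith

/-- The number of coordinates used to make the information bits reliable. -/
def extraSteps (m : ℕ) : ℕ := Nat.log 2 m + 4

theorem tendsto_extraSteps_div_sqrt :
    Tendsto (fun m : ℕ => (extraSteps m : ℝ) / Real.sqrt m) atTop (nhds 0) := by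
  have hsqrt : Tendsto (fun m : ℕ => Real.sqrt m) atTop atTop :=
    Real.tendsto_sqrt_atTop.comp tendsto_natCast_atTop_atTop
  have h1 : Tendsto (fun m : ℕ => Real.log m / Real.sqrt m) atTop (nhds 0) := by
    have := (isLittleO_log_rpow_atTop (r := 1 / 2) (by norm_num)).tendsto_div_nhds_zero
    refine (this.comp tendsto_natCast_atTop_atTop).congr fun m => ?_
    simp [Real.sqrt_eq_rpow]
  have h2 : Tendsto (fun m : ℕ => (4 : ℝ) / Real.sqrt m) atTop (nhds 0) :=
    tendsto_const_nhds.div_atTop hsqrt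
  have h3 := (h1.const_mul (Real.log 2)⁻¹).add h2
  rw [mul_zero, add_zero] at h3
  refine squeeze_zero (fun m => by positivity) (fun m => ?_) h3
  rw [← mul_div_assoc, ← add_div]
  refine div_le_div_of_nonneg_right ?_ (Real.sqrt_nonneg _)
  have := Real.natLog_le_logb m 2
  rw [extraSteps, Nat.cast_add, Nat.cast_ofNat]
  rw [Real.logb, Nat.cast_ofNat, div_eq_inv_mul] at this
  linarith

theorem eventually_le_sub_extraSteps (M : ℕ) :
    ∀ᶠ m in atTop, extraSteps m ≤ m ∧ M ≤ m - extraSteps m := by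
  filter_upwards [tendsto_extraSteps_div_sqrt.eventually (gt_mem_nhds (one_half_pos (α := ℝ))),
    eventually_ge_atTop (2 * M + 1)] with m hm hM
  have hm1 : (1 : ℝ) ≤ m := by exact_mod_cast (by omega : 1 ≤ m)
  have hs : 0 < Real.sqrt m := Real.sqrt_pos.2 (by linarith)
  rw [div_lt_iff₀ hs] at hm
  have hs1 : 1 ≤ Real.sqrt m := Real.one_le_sqrt.2 hm1
  have hs2 := Real.sq_sqrt (by linarith : (0 : ℝ) ≤ m)
  have h2 : (2 * extraSteps m : ℝ) ≤ m := by nlinarith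
  have h3 : 2 * extraSteps m ≤ m := by exact_mod_cast h2
  omega

/-- The order of the capacity-achieving Reed-Muller code of length `2 ^ m`. -/
def rmOrder (W : BinaryChannel 𝒴) (m : ℕ) : ℕ := thetaMax W (m - extraSteps m)

/-- Lowering the order from θ_max at m to `rmOrder` removes at most `extraSteps m` = o(√m) levels,
each of density at most 1 / √m. -/
theorem tendsto_rate_rmOrder {W : BinaryChannel 𝒴} {M : ℕ}
    (hM : ∀ m, M ≤ m → (lowMax W m).Nonempty)
    (hθ : (fun m : ℕ => (thetaMin W m : ℝ) - (thetaMax W m : ℝ))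
      =o[atTop] fun m : ℕ => Real.sqrt (m : ℝ)) :
    Tendsto (fun m => rate (rmCode m (rmOrder W m))) atTop (nhds W.uniformInfo) := by
  rw [Metric.tendsto_nhds]
  intro δ hδ
  -- The polarization error 2η is then at most δ / 4, and the vanishing terms will be below δ / 2.
  set η := min (δ / 8) (1 / 4) with hηdef
  have hη : 0 < η := lt_min (by linarith) (by norm_num)
  have hη1 : η ≤ 1 / 4 := min_le_right _ _
  have hηδ : η ≤ δ / 8 := min_le_left _ _
  set K : ℕ := ⌊1 / (η ^ 2 * (1 - η ^ 2))⌋₊ + 1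
  have hsqrt : Tendsto (fun m : ℕ => Real.sqrt m) atTop atTop :=
    Real.tendsto_sqrt_atTop.comp tendsto_natCast_atTop_atTop
  have h1 : Tendsto (fun m : ℕ => (K : ℝ) / Real.sqrt m) atTop (nhds 0) :=
    tendsto_const_nhds.div_atTop hsqrt
  have h2 : Tendsto (fun m : ℕ => |(thetaMin W m : ℝ) - thetaMax W m| / Real.sqrt m) atTop
      (nhds 0) := by
    have := hθ.tendsto_div_nhds_zero.abs
    rw [abs_zero] at this
    refine this.congr fun m => ?_
    rw [abs_div, abs_of_nonneg (Real.sqrt_nonneg _)]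
  have h3 := (h1.add h2).add tendsto_extraSteps_div_sqrt
  rw [add_zero, add_zero] at h3
  filter_upwards [h3.eventually (gt_mem_nhds (half_pos hδ)), eventually_le_sub_extraSteps M,
    eventually_gt_atTop 0] with m hm hmM hm0
  have hmono := thetaMax_add_bounds (fun m' hm' => hM m' (hmM.2.trans hm')) (extraSteps m)
  rw [Nat.sub_add_cancel hmM.1] at hmono
  have hdim := rmDim_add m hmono.1
  have hlev := card_levels_le m (rmOrder W m) (thetaMax W m)
  have hlev' : ((Finset.univ.filter fun A : Finset (Fin m) =>
      rmOrder W m < A.card ∧ A.card ≤ thetaMax W m).card : ℝ) ≤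
      m.choose (m / 2) * extraSteps m := by
    have : thetaMax W m - rmOrder W m ≤ extraSteps m := by unfold rmOrder; omega
    exact_mod_cast hlev.trans (Nat.mul_le_mul_left _ this)
  have hmain := abs_rmDim_thetaMax_sub_le (hM m (by omega)) hη hη1
  have hdim' : (rmDim m (thetaMax W m) : ℝ) = rmDim m (rmOrder W m) +
      (Finset.univ.filter fun A : Finset (Fin m) =>
        rmOrder W m < A.card ∧ A.card ≤ thetaMax W m).card := by exact_mod_cast hdim
  have hpow : (0 : ℝ) < 2 ^ m := by positivity
  have hrate : rate (rmCode m (rmOrder W m)) = rmDim m (rmOrder W m) / 2 ^ m := rate_rmCode m _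
  have habs : |(rmDim m (rmOrder W m) : ℝ) - 2 ^ m * W.uniformInfo| ≤
      m.choose (m / 2) * (K + |(thetaMin W m : ℝ) - thetaMax W m| + extraSteps m) +
        2 ^ m * (2 * η) := by
    rw [hdim'] at hmain
    rw [abs_le] at hmain ⊢
    have hnn : (0 : ℝ) ≤ (Finset.univ.filter fun A : Finset (Fin m) =>
      rmOrder W m < A.card ∧ A.card ≤ thetaMax W m).card := Nat.cast_nonneg _
    have hnn' : (0 : ℝ) ≤ m.choose (m / 2) * extraSteps m := by positivity
    rw [mul_add _ _ (extraSteps m : ℝ)]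
    constructor <;> linarith [hmain.1, hmain.2]
  have hb := choose_half_div_le hm0
  set S : ℝ := K + |(thetaMin W m : ℝ) - thetaMax W m| + extraSteps m with hS
  have hS0 : 0 ≤ S := by positivity
  rw [Real.dist_eq, hrate]
  calc |(rmDim m (rmOrder W m) : ℝ) / 2 ^ m - W.uniformInfo|
      = |(rmDim m (rmOrder W m) : ℝ) - 2 ^ m * W.uniformInfo| / 2 ^ m := by
        rw [← abs_of_pos hpow, ← abs_div, abs_of_pos hpow, sub_div, mul_div_cancel_left₀ _ hpow.ne']
    _ ≤ (m.choose (m / 2) * S + 2 ^ m * (2 * η)) / 2 ^ m :=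
        div_le_div_of_nonneg_right habs hpow.le
    _ = m.choose (m / 2) / 2 ^ m * S + 2 * η := by field_simp
    _ ≤ 1 / Real.sqrt m * S + 2 * η := by gcongr
    _ = (K / Real.sqrt m + |(thetaMin W m : ℝ) - thetaMax W m| / Real.sqrt m +
          extraSteps m / Real.sqrt m) + 2 * η := by rw [hS]; ring
    _ < δ := by linarith

/-! ### The error probability -/

theorem blockError_nonneg (W : BinaryChannel 𝒴) {m : ℕ} (C : Finset (Word m))
    (d : (Cube m → 𝒴) → Word m) : 0 ≤ blockError W C d :=
  mul_nonneg (by positivity) <| Finset.sum_nonneg fun x _ => Finset.sum_nonneg fun y _ => by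
    split_ifs
    · exact le_rfl
    · exact W.blockProb_nonneg x y

theorem log_two_mul_sum_entropy_le {W : BinaryChannel 𝒴} {m k n : ℕ} (hn : m + k = n)
    (h : (lowMax W m).Nonempty) :
    Real.log 2 * ∑ A : Finset (Fin n) with A.card ≤ thetaMax W m, uncAt entropyUnc W n A ≤
      2 ^ n * (9 / 10) ^ 2 ^ k := by
  subst hn
  rw [Finset.mul_sum]
  calc _ ≤ ∑ A : Finset (Fin (m + k)) with A.card ≤ thetaMax W m, (9 / 10 : ℝ) ^ 2 ^ k :=
        Finset.sum_le_sum fun A hA => (log_two_mul_uncAt_le W A).trans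
          (uncAt_bhattaUnc_le_pow h (Finset.mem_filter.1 hA).2)
    _ ≤ ∑ _A : Finset (Fin (m + k)), (9 / 10 : ℝ) ^ 2 ^ k :=
        Finset.sum_le_sum_of_subset_of_nonneg (Finset.filter_subset _ _)
          fun _ _ _ => by positivity
    _ = _ := by simp

/-- The 4 in `extraSteps` gives 2^k ≥ 8m, and the exponent 8 suffices since 2 · 0.9⁸ < 0.9. -/
theorem two_pow_mul_pow_extraSteps_le (m : ℕ) :
    (2 : ℝ) ^ m * (9 / 10) ^ 2 ^ extraSteps m ≤ (9 / 10) ^ m := by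
  have h1 : 8 * m ≤ 2 ^ extraSteps m := by
    have := Nat.lt_pow_succ_log_self one_lt_two m
    rw [extraSteps, show Nat.log 2 m + 4 = Nat.log 2 m + 1 + 3 by ring, pow_add]
    omega
  calc (2 : ℝ) ^ m * (9 / 10) ^ 2 ^ extraSteps m ≤ 2 ^ m * (9 / 10) ^ (8 * m) := by
        gcongr ?_ * ?_
        exact pow_le_pow_of_le_one (by norm_num) (by norm_num) h1
    _ = (2 * (9 / 10) ^ 8) ^ m := by rw [pow_mul, mul_pow]
    _ ≤ (9 / 10) ^ m := pow_le_pow_left₀ (by norm_num) (by norm_num) m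

theorem tendsto_blockError_rmOrder {W : BinaryChannel 𝒴} {M : ℕ}
    (hM : ∀ m, M ≤ m → (lowMax W m).Nonempty) {d : (m : ℕ) → (Cube m → 𝒴) → Word m}
    (hd : ∀ m, blockError W (rmCode m (rmOrder W m)) (d m) ≤ Real.log 2 *
      ∑ A : Finset (Fin m) with A.card ≤ rmOrder W m, uncAt entropyUnc W m A) :
    Tendsto (fun m => blockError W (rmCode m (rmOrder W m)) (d m)) atTop (nhds 0) := by
  refine squeeze_zero' (Eventually.of_forall fun m => blockError_nonneg W _ _) ?_
    (tendsto_pow_atTop_nhds_zero_of_lt_one (r := (9 / 10 : ℝ)) (by norm_num) (by norm_num))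
  filter_upwards [eventually_le_sub_extraSteps M] with m hm
  exact (hd m).trans ((log_two_mul_sum_entropy_le (Nat.sub_add_cancel hm.1) (hM _ hm.2)).trans
    (two_pow_mul_pow_extraSteps_le m))

end RMCapacity

end

theorem mainTheorem7 {𝒴 : Type*} [Fintype 𝒴] (W : RMCapacity.BinaryChannel 𝒴)
    (hW : W.IsSymmetric)
    (hdef : ∀ᶠ m in atTop, (RMCapacity.lowMax W m).Nonempty ∧ (RMCapacity.lowMin W m).Nonempty)
    (hθ : (fun m : ℕ => (RMCapacity.thetaMin W m : ℝ) - (RMCapacity.thetaMax W m : ℝ))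
      =o[atTop] fun m : ℕ => Real.sqrt (m : ℝ)) :
    RMCapacity.ReedMullerAchievesCapacity W := by
  obtain ⟨M, hM⟩ := eventually_atTop.1 hdef
  choose d hd using fun m =>
    RMCapacity.exists_decoder_blockError_le hW m (RMCapacity.rmOrder W m)
  refine ⟨RMCapacity.rmOrder W, d, fun m => ?_, ?_, ?_⟩
  · exact (RMCapacity.thetaMax_le W _).trans (Nat.sub_le _ _)
  · rw [RMCapacity.capacity_eq_uniformInfo hW]
    exact RMCapacity.tendsto_rate_rmOrder (fun m hm => (hM m hm).1) hθ
  · exact RMCapacity.tendsto_blockError_rmOrder (fun m hm => (hM m hm).1) hd
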